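/- **Setting.** A receiver in the $xz$-plane has $N_{\rm RF}$ microstrips with $N_{\rm E}$ metamaterials each, $N=N_{\rm RF}N_{\rm E}$. The $n$-th metamaterial of the $i$-th microstrip sits at $((i-1)d_{\rm RF},0,(n-1)d_{\rm E})$. There are $U$ single-antenna users at spherical coordinates $(r_u,\theta_u,\phi_u)$, collected in $\zeta=[r_1,\theta_1,\phi_1,\dots,r_U,\theta_U,\phi_U]^{\rm T}\in\mathbb R^{3U}$. With $$r_{u,i,n}=\big((r_u\sin\theta_u\cos\phi_u-(i-1)d_{\rm RF})^2+(r_u\sin\theta_u\sin\phi_u)^2+(r_u\cos\theta_u-(n-1)d_{\rm E})^2\big)^{1/2},$$ $$\theta_{u,i,n}=\arcsin\big(r_{u,i,n}^{-1}|(n-1)d_{\rm E}-r_u\cos\theta_u|\big),$$ wavelength $\lambda>0$, absorption coefficient $\kappa_{\rm abs}$ and radiation profile $F_b(\theta)=2(b+1)\cos^b\theta$ for $\theta\in[-\frac\pi2,\frac\pi2]$ and $0$ otherwise, the channel of user $u$ is the $1\times N$ row $h_u=h_u(\zeta)$ with entries $$[h_u]_{(i-1)N_{\rm E}+n}=\sqrt{F_b(\theta_{u,i,n})}\,\frac{\lambda}{4\pi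 r_{u,i,n}}\,e^{-\kappa_{\rm abs}r_{u,i,n}/2}\,e^{\jmath 2\pi r_{u,i,n}/\lambda}.$$ Let $P$ be the diagonal $N\times N$ matrix with entries $\exp(-\rho_{i,n}(\alpha_i+\jmath\beta_i))$, and let $W\in\mathbb C^{N\times N_{\rm RF}}$ have the entries $[W]_{(i-1)N_{\rm E}+n,j}=w_{i,n}$ if $i=j$ and $0$ otherwise, for complex weights $w_{i,n}$. Let $s_u\in\mathbb C^{1\times T}$ be known pilot rows. The received signal is $$Y=W^{\rm H}P^{\rm H}\sum_{u=1}^U h_u^{\rm H}s_u+W^{\rm H}P^{\rm H}\mathbf N ,$$ where the $T$ columns of the noise $\mathbf N$ are independent and $\mathcal{CN}(0,\sigma^2 I_N)$, $\sigma>0$. Put $M(\zeta)=W^{\rm H}P^{\rm H}\sum_u h_u^{\rm H}s_u$ and $R_n=\sigma^2W^{\rm H}P^{\rm H}PW$, assume that $R_n$ is invertible, and let $F=WR_n^{-1}W^{\rm H}$. The real part of a matrix is taken entrywise. **Claim.** 1. For every $\zeta$ the columns of $Y$ are independent, the $t$-th one being $\mathcal{CN}([M(\zeta)]_{:,t},R_n)$.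 Thus $Y$ has the product of the corresponding complex Gaussian densities as its likelihood $p(\cdot;\zeta)$, its entries are square integrable, its mean is $M(\zeta)$, and its covariance ($R_n$ within a column, $0$ between different columns) does not depend on $\zeta$. Now let $\zeta$ be such that no user lies on the straight line carrying a microstrip, that is, for all $u,i$: $r_u\sin\theta_u\cos\phi_u\ne(i-1)d_{\rm RF}$ or $r_u\sin\theta_u\sin\phi_u\neq0$. Then all $h_u$ and $\log p(y;\cdot)$ (for every $y$) are differentiable at $\zeta$, the products of scores are integrable, and the $3U\times3U$ Fisher information matrix $\mathcal I_{i,j}=\mathbb E_\zeta[\partial_{\zeta_i}\log p\;\partial_{\zeta_j}\log p]$ satisfies the following. 2. Only the mean contributes: $\mathcal I_{i,j}=2\,\Re\,{\rm Tr}\{\frac{\partial M^{\rm H}}{\partial\zeta_i}R_n^{-1}\frac{\partial M}{\partial\zeta_j}\}$ for all $i,j$, where $\frac{\partial M}{\partial\zeta_i}=W^{\rm H}P^{\rm H}\sum_u\frac{\partial h_u^{\rm H}}{\partial\zeta_i}s_u$. 3. For every $i$, as an identity of $T\times T$ matrices, $$2\Re\Big\{\frac{\partial M^{\rm H}}{\partial\zeta_i}R_n^{-1}\frac{\partial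 M}{\partial\zeta_i}\Big\}=2\sum_{u=1}^U\Re\Big\{s_u^{\rm H}\frac{\partial h_u}{\partial\zeta_i}PFP^{\rm H}\frac{\partial h_u^{\rm H}}{\partial\zeta_i}s_u\Big\},$$ and the diagonal entry of the Fisher information matrix is its trace, $$\mathcal I_{i,i}=2\sum_{u=1}^U\Re\,{\rm Tr}\Big\{s_u^{\rm H}\frac{\partial h_u}{\partial\zeta_i}PFP^{\rm H}\frac{\partial h_u^{\rm H}}{\partial\zeta_i}s_u\Big\}.$$ 4. If $\mathcal I$ is invertible, the position error bound is ${\rm PEB}_\zeta=\sqrt{{\rm Tr}\{\mathcal I^{-1}\}}$: one has ${\rm Tr}\{\mathcal I^{-1}\}\ge0$, and ${\rm PEB}_\zeta$ is the smallest value of the root mean square error $\sqrt{\mathbb E_\zeta\|\hat\zeta(Y)-\zeta\|^2}$ over all estimators $\hat\zeta$ with finite second moments at $\zeta$ that are locally unbiased at $\zeta$, i.e. $\mathbb E_\zeta[\hat\zeta_k]=\zeta_k$ and $\partial_{\zeta_j}\mathbb E_\zeta[\hat\zeta_k]=\delta_{kj}$ for all $k,j$. (Every estimator with finite second moments at $\zeta$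 that is unbiased near $\zeta$ is locally unbiased at $\zeta$.) -/

import Mathlib

open MeasureTheory ProbabilityTheory
open scoped Matrix

noncomputable section

/-! ### Partial derivatives -/

/-- The partial derivative `∂f/∂ζ_i` at `ζ` of a function of finitely many real parameters. -/
def partialDeriv {κ E : Type*} [DecidableEq κ] [NormedAddCommGroup E] [NormedSpace ℝ E]
    (f : (κ → ℝ) → E) (i : κ) (ζ : κ → ℝ) : E :=
  deriv (fun x : ℝ => f (Function.update ζ i x)) (ζ i)

/-- The entrywise partial derivative `∂A/∂ζ_i` of a matrix depending on real parameters. -/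
def matPartialDeriv {κ m n : Type*} [DecidableEq κ]
    (A : (κ → ℝ) → Matrix m n ℂ) (i : κ) (ζ : κ → ℝ) : Matrix m n ℂ :=
  Matrix.of fun a b => partialDeriv (fun z => A z a b) i ζ

/-! ### Complex Gaussian vectors -/

/-- The density `(π^n det R)⁻¹ exp (-(y - m)ᴴ R⁻¹ (y - m))` of the circularly symmetric complex
Gaussian vector with mean `m` and (positive definite) covariance matrix `R`. -/
def complexGaussianPDF {ι : Type*} [Fintype ι] [DecidableEq ι]
    (m : ι → ℂ) (R : Matrix ι ι ℂ) (y : ι → ℂ) : ℝ :=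
  (Real.pi ^ Fintype.card ι * R.det.re)⁻¹ *
    Real.exp (-(star (y - m) ⬝ᵥ (R⁻¹ *ᵥ (y - m))).re)

/-- The law `CN(m, R)`, for a positive definite covariance matrix `R`. -/
def complexGaussian {ι : Type*} [Fintype ι] [DecidableEq ι]
    (m : ι → ℂ) (R : Matrix ι ι ℂ) : Measure (ι → ℂ) :=
  (volume : Measure (ι → ℂ)).withDensity fun y => ENNReal.ofReal (complexGaussianPDF m R y)

/-! ### Fisher information and locally unbiased estimators

A parametric model is a family `Q z` of laws on a space `X` of observations, `z` ranging over
vectors of real parameters; `p z y` is its likelihood. -/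

/-- The score `∂ log p(y; ζ) / ∂ζ_i`. -/
def score {κ X : Type*} [DecidableEq κ] (p : (κ → ℝ) → X → ℝ) (ζ : κ → ℝ) (i : κ) (y : X) : ℝ :=
  partialDeriv (fun z => Real.log (p z y)) i ζ

/-- The Fisher information matrix, with entries
`E_ζ[(∂ log p(y; ζ) / ∂ζ_i) (∂ log p(y; ζ) / ∂ζ_j)]`. -/
def fisherInformation {κ X : Type*} [DecidableEq κ] [MeasurableSpace X]
    (Q : (κ → ℝ) → Measure X) (p : (κ → ℝ) → X → ℝ) (ζ : κ → ℝ) : Matrix κ κ ℝ :=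
  Matrix.of fun i j => ∫ y, score p ζ i y * score p ζ j y ∂(Q ζ)

/-- An estimator of `ζ` with finite second moments at `ζ` whose expectation agrees with the
parameter to first order at `ζ`. An estimator with finite second moments at `ζ` that is unbiased
at all parameters near `ζ` has this property. -/
structure IsLocallyUnbiased {κ X : Type*} [DecidableEq κ] [MeasurableSpace X]
    (Q : (κ → ℝ) → Measure X) (ζ : κ → ℝ) (est : X → κ → ℝ) : Prop where
  measurable : Measurable est
  memLp : ∀ k, MemLp (fun y => est y k) 2 (Q ζ)
  unbiased : ∀ k, ∫ y, est y k ∂(Q ζ) = ζ k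
  hasDerivAt : ∀ k j, HasDerivAt (fun x : ℝ => ∫ y, est y k ∂(Q (Function.update ζ j x)))
    (if k = j then 1 else 0) (ζ j)

/-- The root mean square error `√(E_ζ ‖est(y) - ζ‖²)` (Euclidean norm) of an estimator. -/
def rmse {κ X : Type*} [Fintype κ] [MeasurableSpace X]
    (Q : (κ → ℝ) → Measure X) (ζ : κ → ℝ) (est : X → κ → ℝ) : ℝ :=
  Real.sqrt (∫ y, ∑ k, (est y k - ζ k) ^ 2 ∂(Q ζ))

/-! ### The receiver with a dynamic metasurface antenna -/

/-- The data of the system: `NRF` microstrips with `NE` metamaterials each, `U` users, `T` pilot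
transmissions per user. -/
structure DMASystem (NRF NE U T : ℕ) where
  /-- distance between adjacent metamaterials of a microstrip -/
  dE : ℝ
  /-- distance between adjacent microstrips -/
  dRF : ℝ
  /-- wavelength -/
  lam : ℝ
  /-- molecular absorption coefficient -/
  kabs : ℝ
  /-- exponent of the radiation profile -/
  b : ℝ
  /-- standard deviation of the noise -/
  sigma : ℝ
  /-- waveguide attenuation coefficients -/
  alpha : Fin NRF → ℝ
  /-- wavenumbers of the microstrips -/
  beta : Fin NRF → ℝ
  /-- positions of the metamaterials within the microstrips -/
  rho : Fin NRF → Fin NE → ℝ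
  /-- analog weights of the metamaterials -/
  w : Fin NRF → Fin NE → ℂ
  /-- pilot signals, as `1 × T` rows -/
  s : Fin U → Matrix Unit (Fin T) ℂ

namespace DMASystem

variable {NRF NE U T : ℕ} (S : DMASystem NRF NE U T)

/-- Propagation inside the microstrips: the diagonal matrix with entries
`exp (-ρ_{i,n} (α_i + j β_i))`. -/
def P : Matrix (Fin NRF × Fin NE) (Fin NRF × Fin NE) ℂ :=
  Matrix.diagonal fun a =>
    Complex.exp (-(S.rho a.1 a.2 : ℂ) * ((S.alpha a.1 : ℂ) + Complex.I * (S.beta a.1 : ℂ)))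

/-- The analog beamforming matrix. -/
def W : Matrix (Fin NRF × Fin NE) (Fin NRF) ℂ :=
  Matrix.of fun a j => if a.1 = j then S.w a.1 a.2 else 0

/-- `R_n = σ² Wᴴ Pᴴ P W`. -/
def noiseCov : Matrix (Fin NRF) (Fin NRF) ℂ :=
  ((S.sigma : ℂ) ^ 2) • (S.Wᴴ * S.Pᴴ * S.P * S.W)

/-- `F = W R_n⁻¹ Wᴴ`. -/
def F : Matrix (Fin NRF × Fin NE) (Fin NRF × Fin NE) ℂ :=
  S.W * S.noiseCov⁻¹ * S.Wᴴ

/-- The parameter vector is indexed by `Fin U × Fin 3`: the entries `(u, 0)`, `(u, 1)`, `(u, 2)`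
are the range, the elevation angle and the azimuth angle of user `u`. The Cartesian coordinates
of user `u` are `(xPos, yPos, zPos)`. -/
def xPos (z : Fin U × Fin 3 → ℝ) (u : Fin U) : ℝ :=
  z (u, 0) * Real.sin (z (u, 1)) * Real.cos (z (u, 2))

/-- See `xPos`. -/
def yPos (z : Fin U × Fin 3 → ℝ) (u : Fin U) : ℝ :=
  z (u, 0) * Real.sin (z (u, 1)) * Real.sin (z (u, 2))

/-- See `xPos`. -/
def zPos (z : Fin U × Fin 3 → ℝ) (u : Fin U) : ℝ :=
  z (u, 0) * Real.cos (z (u, 1))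

/-- Distance from user `u` to metamaterial `a.2` of microstrip `a.1`, which sits at
`(a.1 dRF, 0, a.2 dE)` (indices start at `0`). -/
def dist (z : Fin U × Fin 3 → ℝ) (u : Fin U) (a : Fin NRF × Fin NE) : ℝ :=
  Real.sqrt ((xPos z u - (a.1 : ℕ) * S.dRF) ^ 2 + (yPos z u) ^ 2 +
    (zPos z u - (a.2 : ℕ) * S.dE) ^ 2)

/-- Elevation angle of user `u` with respect to metamaterial `a`. -/
def elev (z : Fin U × Fin 3 → ℝ) (u : Fin U) (a : Fin NRF × Fin NE) : ℝ :=
  Real.arcsin ((S.dist z u a)⁻¹ * |(a.2 : ℕ) * S.dE - zPos z u|)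

open Classical in
/-- Radiation profile of a metamaterial. -/
def radiation (θ : ℝ) : ℝ :=
  if θ ∈ Set.Icc (-(Real.pi / 2)) (Real.pi / 2) then 2 * (S.b + 1) * Real.cos θ ^ S.b else 0

/-- Attenuation factor. -/
def atten (z : Fin U × Fin 3 → ℝ) (u : Fin U) (a : Fin NRF × Fin NE) : ℝ :=
  Real.sqrt (S.radiation (S.elev z u a)) * (S.lam / (4 * Real.pi * S.dist z u a)) *
    Real.exp (-(S.kabs * S.dist z u a) / 2)

/-- The near-field channel of user `u`, as a `1 × N` row. -/
def h (z : Fin U × Fin 3 → ℝ) (u : Fin U) : Matrix Unit (Fin NRF × Fin NE) ℂ :=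
  Matrix.of fun _ a => (S.atten z u a : ℂ) *
    Complex.exp (Complex.I * ((2 * Real.pi / S.lam * S.dist z u a : ℝ) : ℂ))

/-- The mean `M = Wᴴ Pᴴ ∑ u, h_uᴴ s_u`. -/
def mean (z : Fin U × Fin 3 → ℝ) : Matrix (Fin NRF) (Fin T) ℂ :=
  S.Wᴴ * S.Pᴴ * ∑ u, (S.h z u)ᴴ * S.s u

/-- The received signal `Y = Wᴴ Pᴴ ∑ u, h_uᴴ s_u + Wᴴ Pᴴ N` for the noise matrix `N`. -/
def received (z : Fin U × Fin 3 → ℝ) (N : Matrix (Fin NRF × Fin NE) (Fin T) ℂ) :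
    Matrix (Fin NRF) (Fin T) ℂ :=
  S.Wᴴ * S.Pᴴ * (∑ u, (S.h z u)ᴴ * S.s u) + S.Wᴴ * S.Pᴴ * N

/-- The law `CN(M, R_n)` of the columns of the received signal: independent columns, the `t`-th
one complex Gaussian with mean the `t`-th column of `M` and covariance matrix `R_n`. -/
def obsLaw (z : Fin U × Fin 3 → ℝ) : Measure (Fin T → Fin NRF → ℂ) :=
  Measure.pi fun t => complexGaussian (fun a => S.mean z a t) S.noiseCov

/-- The likelihood of the columns of the received signal. -/
def likelihood (z : Fin U × Fin 3 → ℝ) (y : Fin T → Fin NRF → ℂ) : ℝ :=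
  ∏ t, complexGaussianPDF (fun a => S.mean z a t) S.noiseCov (y t)

/-- The Fisher information matrix of the received signal for the parameter vector `ζ`. -/
def fim (ζ : Fin U × Fin 3 → ℝ) : Matrix (Fin U × Fin 3) (Fin U × Fin 3) ℝ :=
  fisherInformation S.obsLaw S.likelihood ζ

/-- The position error bound `√Tr(FIM⁻¹)`. -/
def peb (ζ : Fin U × Fin 3 → ℝ) : ℝ :=
  Real.sqrt (S.fim ζ)⁻¹.trace

/-- No user lies on the line that carries a microstrip. -/
def OffMicrostripLines (ζ : Fin U × Fin 3 → ℝ) : Prop :=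
  ∀ (u : Fin U) (i : Fin NRF), xPos ζ u ≠ (i : ℕ) * S.dRF ∨ yPos ζ u ≠ 0

end DMASystem

end

noncomputable section

/-! ### Products of measures with densities -/

/-! Everything rests on the factorization `R_n = C Cᴴ` with `C = σ Wᴴ Pᴴ` (`noiseCov_eq`): each
received column is an affine image of a standard complex Gaussian vector. The characteristic
function of `A x` depends on `A` only through `A Aᴴ`, so a rectangular `A` may be exchanged for a
square factor of `A Aᴴ`. When that factor is invertible, the density comes from a linear change of
variables (`map_affine_stdComplexVec`).

The covariance is constant in the parameters, so the score is the real-linear form `2 ∑ₜ Re (∂Mₜᴴ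
R_n⁻¹ (yₜ - Mₜ))`. By circular symmetry `E[v vᵀ] = 0` for the centred signal `v`, hence a product of
two real parts keeps half of the Hermitian covariance; `4 · 1/2` is the factor `2` in the Fisher
information (`integral_colPairing_sub_mul`, `fim_apply`). A coordinate of the parameter belongs to
one user only, so the derivatives of all other channels vanish and no cross terms appear in the
diagonal entries (`matPartialDeriv_h_eq_zero`).

For the error bound, a change of measure to a fixed Gaussian shows `∂ⱼ E[f] = E[f sⱼ]` for every
square integrable `f` (`hasDerivAt_integral_gaussianColumns`). Local unbiasedness thus says that the
error `eₖ` satisfies `E[eₖ sⱼ] = δₖⱼ`. With `gₖ = ∑ⱼ (J⁻¹)ₖⱼ sⱼ`, where `J` is the Fisher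
information, this gives `E[eₖ gₖ] = (J⁻¹)ₖₖ = E[gₖ²]`, so `E[eₖ²] ≥ (J⁻¹)ₖₖ`, and `ζ + g` attains
equality (`cramerRao_isLeast`). -/

theorem pi_withDensity_ofReal {ι : Type*} [Fintype ι] {X : ι → Type*}
    [∀ i, MeasurableSpace (X i)] (μ : ∀ i, Measure (X i)) [∀ i, SigmaFinite (μ i)]
    (f : ∀ i, X i → ℝ) (hf0 : ∀ i x, 0 ≤ f i x) (hfi : ∀ i, Integrable (f i) (μ i)) :
    Measure.pi (fun i => (μ i).withDensity fun x => ENNReal.ofReal (f i x)) =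
      (Measure.pi μ).withDensity fun x => ENNReal.ofReal (∏ i, f i (x i)) := by
  refine Measure.pi_eq fun s hs => ?_
  have hp : Integrable (fun x : ∀ i, X i => ∏ i, f i (x i))
      (Measure.pi fun i => (μ i).restrict (s i)) :=
    Integrable.fintype_prod_dep fun i => (hfi i).restrict
  rw [withDensity_apply _ (MeasurableSet.univ_pi hs), Measure.restrict_pi_pi,
    ← ofReal_integral_eq_lintegral_ofReal hp
      (Filter.Eventually.of_forall fun x => Finset.prod_nonneg fun i _ => hf0 i _),
    integral_fintype_prod_eq_prod,
    ENNReal.ofReal_prod_of_nonneg fun i _ => integral_nonneg (hf0 i)]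
  refine Finset.prod_congr rfl fun i _ => ?_
  rw [withDensity_apply _ (hs i), ofReal_integral_eq_lintegral_ofReal (hfi i).restrict
    (Filter.Eventually.of_forall (hf0 i))]

/-! ### The standard complex Gaussian law on `ℂ` -/

/-- The density of the standard complex Gaussian law. -/
def stdComplexPDF (z : ℂ) : ℝ := Real.pi⁻¹ * Real.exp (-‖z‖ ^ 2)

/-- The standard complex Gaussian law `CN(0, 1)`. -/
def stdComplex : Measure ℂ := volume.withDensity fun z => ENNReal.ofReal (stdComplexPDF z)

theorem stdComplexPDF_nonneg (z : ℂ) : 0 ≤ stdComplexPDF z := by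
  unfold stdComplexPDF; positivity

theorem continuous_stdComplexPDF : Continuous stdComplexPDF := by
  unfold stdComplexPDF; fun_prop

/-- Since `C r ≤ r²/2 + C²/2`, half of the Gaussian exponent absorbs the exponential weight. These
moments are the source of all integrability below. -/
theorem integrable_exp_mul_norm_mul_stdComplexPDF (C : ℝ) :
    Integrable fun z : ℂ => stdComplexPDF z * Real.exp (C * ‖z‖) := by
  have h : Integrable fun z : ℂ => Real.exp (-(1 / 2 : ℝ) * ‖z‖ ^ 2) := by
    have := (GaussianFourier.integrable_cexp_neg_mul_sq_norm_add (V := ℂ) (b := 1 / 2)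
      (by norm_num) 0 0).norm
    refine this.congr (Filter.Eventually.of_forall fun z => ?_)
    simp [Complex.norm_exp, ← Complex.ofReal_pow]
  refine (h.const_mul (Real.pi⁻¹ * Real.exp (C ^ 2 / 2))).mono'
    (by unfold stdComplexPDF; fun_prop) (Filter.Eventually.of_forall fun z => ?_)
  have := Real.pi_pos
  rw [Real.norm_of_nonneg (mul_nonneg (stdComplexPDF_nonneg z) (Real.exp_nonneg _)),
    stdComplexPDF, mul_assoc, mul_assoc, ← Real.exp_add, ← Real.exp_add]
  refine mul_le_mul_of_nonneg_left (Real.exp_le_exp.2 ?_) (by positivity)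
  nlinarith [sq_nonneg (‖z‖ - C)]

theorem integrable_stdComplexPDF : Integrable stdComplexPDF := by
  simpa using integrable_exp_mul_norm_mul_stdComplexPDF 0

theorem integral_stdComplex {E : Type*} [NormedAddCommGroup E] [NormedSpace ℝ E] (f : ℂ → E) :
    ∫ z, f z ∂stdComplex = ∫ z, stdComplexPDF z • f z := by
  rw [stdComplex, integral_withDensity_eq_integral_toReal_smul
    continuous_stdComplexPDF.measurable.ennreal_ofReal (by simp)]
  simp [ENNReal.toReal_ofReal (stdComplexPDF_nonneg _)]

theorem integrable_stdComplex_iff {E : Type*} [NormedAddCommGroup E] [NormedSpace ℝ E]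
    {f : ℂ → E} : Integrable f stdComplex ↔ Integrable fun z => stdComplexPDF z • f z := by
  rw [stdComplex, integrable_withDensity_iff_integrable_smul'
    continuous_stdComplexPDF.measurable.ennreal_ofReal (by simp)]
  simp [ENNReal.toReal_ofReal (stdComplexPDF_nonneg _)]

/-- The Fourier transform of a Gaussian. The case `c = 0` also supplies the normalization of the
density. -/
theorem integral_stdComplexPDF_mul_cexp (c : ℂ) :
    ∫ z : ℂ, (stdComplexPDF z : ℂ) * Complex.exp (((inner ℝ c z : ℝ) : ℂ) * Complex.I) =
      Complex.exp (-(‖c‖ : ℂ) ^ 2 / 4) := by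
  have h := GaussianFourier.integral_cexp_neg_mul_sq_norm_add (V := ℂ) (b := 1)
    (by norm_num) Complex.I c
  have hpi : (Real.pi : ℂ) ≠ 0 := by exact_mod_cast Real.pi_ne_zero
  simp only [Complex.finrank_real_complex, Nat.cast_ofNat, div_one, ne_eq, OfNat.ofNat_ne_zero,
    not_false_eq_true, div_self, Complex.cpow_one, Complex.I_sq, mul_one, neg_one_mul] at h
  calc _ = ∫ z : ℂ, (Real.pi : ℂ)⁻¹ *
        Complex.exp (-(‖z‖ : ℂ) ^ 2 + Complex.I * ((inner ℝ c z : ℝ) : ℂ)) := by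
        congr 1 with z
        simp only [stdComplexPDF]
        push_cast
        rw [mul_assoc, ← Complex.exp_add, mul_comm Complex.I]
    _ = _ := by
        rw [integral_const_mul, h, inv_mul_cancel_left₀ hpi]

instance : IsProbabilityMeasure stdComplex := by
  refine ⟨?_⟩
  have h := integral_stdComplexPDF_mul_cexp 0
  simp only [inner_zero_left, Complex.ofReal_zero, zero_mul, Complex.exp_zero, mul_one, norm_zero,
    ne_eq, OfNat.ofNat_ne_zero, not_false_eq_true, zero_pow, neg_zero, zero_div] at h
  rw [integral_complex_ofReal] at h
  rw [stdComplex, withDensity_apply _ MeasurableSet.univ, Measure.restrict_univ,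
    ← ofReal_integral_eq_lintegral_ofReal integrable_stdComplexPDF
      (Filter.Eventually.of_forall stdComplexPDF_nonneg)]
  have h' : ∫ z, stdComplexPDF z = 1 := by exact_mod_cast h
  rw [h', ENNReal.ofReal_one]

theorem integrable_exp_mul_norm_stdComplex (C : ℝ) :
    Integrable (fun z => Real.exp (C * ‖z‖)) stdComplex :=
  integrable_stdComplex_iff.2 (integrable_exp_mul_norm_mul_stdComplexPDF C)

/-- Multiplication by `i` is a linear isometry, and the density depends on the norm only. This
single rotation kills the mean (`E z = i E z`) and the pseudo-variance (`E z² = -E z²`). -/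
theorem integral_stdComplex_comp_I_mul {E : Type*} [NormedAddCommGroup E] [NormedSpace ℝ E]
    (f : ℂ → E) : ∫ z, f (Complex.I * z) ∂stdComplex = ∫ z, f z ∂stdComplex := by
  have hI : ‖Complex.I‖ = 1 := Complex.norm_I
  let e : ℂ ≃ₗᵢ[ℝ] ℂ := rotation ⟨Complex.I, by simp [Submonoid.unitSphere]⟩
  have he : ∀ z, e z = Complex.I * z := fun z => rfl
  rw [integral_stdComplex, integral_stdComplex,
    ← (e.measurePreserving).integral_comp e.toHomeomorph.measurableEmbedding
      (fun z => stdComplexPDF z • f z)]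
  congr 1 with z
  simp only [he, stdComplexPDF, norm_mul, hI, one_mul]

theorem integral_id_stdComplex : ∫ z, z ∂stdComplex = 0 := by
  have h := integral_stdComplex_comp_I_mul fun z => z
  rw [integral_const_mul] at h
  have : (Complex.I - 1) * ∫ z, z ∂stdComplex = 0 := by rw [sub_mul, h]; ring
  refine (mul_eq_zero.1 this).resolve_left fun h => ?_
  simpa using congrArg Complex.re h

theorem integral_sq_stdComplex : ∫ z, z * z ∂stdComplex = 0 := by
  have h := integral_stdComplex_comp_I_mul fun z => z * z
  have h2 : ∀ z, Complex.I * z * (Complex.I * z) = -(z * z) := fun z => by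
    linear_combination z * z * Complex.I_mul_I
  simp_rw [h2, integral_neg] at h
  exact self_eq_neg.1 h.symm

theorem integral_mul_star_stdComplex : ∫ z, z * star z ∂stdComplex = 1 := by
  have h := Complex.integral_rpow_mul_exp_neg_rpow (p := 2) (q := 2) (by norm_num) (by norm_num)
  have hG : Real.Gamma ((2 + 2) / 2) = 1 := by
    rw [show ((2 : ℝ) + 2) / 2 = 2 by norm_num, Real.Gamma_two]
  rw [hG] at h
  rw [integral_stdComplex]
  calc _ = ∫ z : ℂ, ((Real.pi⁻¹ * (‖z‖ ^ (2 : ℝ) * Real.exp (-‖z‖ ^ (2 : ℝ))) : ℝ) : ℂ) := by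
        congr 1 with z
        rw [Complex.star_def, Complex.mul_conj', stdComplexPDF, Complex.real_smul]
        norm_num
        ring
    _ = 1 := by
        rw [integral_complex_ofReal, integral_const_mul, h]
        have := Real.pi_ne_zero
        norm_num [this]

theorem charFunDual_stdComplex (L : StrongDual ℝ ℂ) :
    charFunDual stdComplex L = Complex.exp (-(‖(InnerProductSpace.toDual ℝ ℂ).symm L‖ : ℂ) ^ 2 / 4) := by
  rw [charFunDual_apply, integral_stdComplex, ← integral_stdComplexPDF_mul_cexp]
  simp [InnerProductSpace.toDual_symm_apply]

/-! ### Linear images of the standard complex Gaussian law -/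

/-- The law of a vector of independent standard complex Gaussian variables. -/
def stdComplexVec (κ : Type*) [Fintype κ] : Measure (κ → ℂ) := Measure.pi fun _ => stdComplex

instance {κ : Type*} [Fintype κ] : IsProbabilityMeasure (stdComplexVec κ) := by
  unfold stdComplexVec; infer_instance

/-- Riesz representation in each coordinate. It brings the real-linear functionals of the
characteristic function into a form on which complex matrices act by their adjoints. -/
theorem exists_strongDual_eq_re_dotProduct {ι : Type*} [Fintype ι] [DecidableEq ι]
    (L : StrongDual ℝ (ι → ℂ)) : ∃ c : ι → ℂ, ∀ x, L x = (star c ⬝ᵥ x).re := by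
  refine ⟨fun i => (InnerProductSpace.toDual ℝ ℂ).symm (L.comp (.single ℝ (fun _ => ℂ) i)), fun x => ?_⟩
  rw [← L.sum_comp_single, dotProduct, Complex.re_sum]
  refine Finset.sum_congr rfl fun i _ => ?_
  have := InnerProductSpace.toDual_symm_apply (𝕜 := ℝ) (x := x i)
    (y := L.comp (ContinuousLinearMap.single ℝ (fun _ => ℂ) i))
  rw [Pi.star_apply]
  rw [← this, Complex.inner, Complex.star_def, mul_comm]

theorem charFunDual_stdComplexVec {κ : Type*} [Fintype κ] [DecidableEq κ]
    (L : StrongDual ℝ (κ → ℂ)) (c : κ → ℂ) (hc : ∀ x, L x = (star c ⬝ᵥ x).re) :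
    charFunDual (stdComplexVec κ) L = Complex.exp (-(star c ⬝ᵥ c) / 4) := by
  rw [stdComplexVec, charFunDual_pi]
  simp_rw [charFunDual_stdComplex]
  rw [← Complex.exp_sum]
  congr 1
  rw [dotProduct, neg_div, Finset.sum_div, ← Finset.sum_neg_distrib]
  refine Finset.sum_congr rfl fun k _ => ?_
  have : (InnerProductSpace.toDual ℝ ℂ).symm (L.comp (.single ℝ (fun _ => ℂ) k)) = c k := by
    refine ext_inner_right ℝ fun z => ?_
    rw [InnerProductSpace.toDual_symm_apply, ContinuousLinearMap.comp_apply, hc,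
      ContinuousLinearMap.single_apply, dotProduct_single, Complex.inner,
      Pi.star_apply, Complex.star_def, mul_comm]
  rw [this, neg_div, Pi.star_apply, Complex.star_def, Complex.conj_mul']

theorem measurable_mulVec {ι κ : Type*} [Finite ι] [Fintype κ] (A : Matrix ι κ ℂ) :
    Measurable fun x : κ → ℂ => A *ᵥ x :=
  (Continuous.matrix_mulVec continuous_const continuous_id).measurable

theorem charFunDual_map_mulVec_stdComplexVec {ι κ : Type*} [Fintype ι] [Fintype κ]
    (A : Matrix ι κ ℂ) (L : StrongDual ℝ (ι → ℂ)) (c : ι → ℂ)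
    (hc : ∀ x, L x = (star c ⬝ᵥ x).re) :
    charFunDual ((stdComplexVec κ).map fun x => A *ᵥ x) L =
      Complex.exp (-(star c ⬝ᵥ ((A * Aᴴ) *ᵥ c)) / 4) := by
  classical
  let LA : (κ → ℂ) →L[ℝ] (ι → ℂ) := LinearMap.toContinuousLinearMap
    (A.mulVecLin.restrictScalars ℝ)
  have hLA : (fun x => A *ᵥ x) = ⇑LA := rfl
  rw [hLA, charFunDual_map, charFunDual_stdComplexVec _ (Aᴴ *ᵥ c)]
  · rw [Matrix.star_mulVec, Matrix.conjTranspose_conjTranspose, ← Matrix.dotProduct_mulVec,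
      Matrix.mulVec_mulVec]
  · intro x
    rw [ContinuousLinearMap.comp_apply, hc, ← hLA, Matrix.star_mulVec,
      Matrix.conjTranspose_conjTranspose, ← Matrix.dotProduct_mulVec]

/-- The characteristic function sees only `A * Aᴴ`, and it determines the law. The source dimensions
may differ, which allows a rectangular matrix to be traded for a square one. -/
theorem map_mulVec_stdComplexVec_congr {ι κ κ' : Type*} [Fintype ι] [Fintype κ] [Fintype κ']
    (A : Matrix ι κ ℂ) (B : Matrix ι κ' ℂ) (h : A * Aᴴ = B * Bᴴ) :
    (stdComplexVec κ).map (fun x => A *ᵥ x) = (stdComplexVec κ').map fun x => B *ᵥ x := by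
  classical
  have := Measure.isProbabilityMeasure_map (μ := stdComplexVec κ) (measurable_mulVec A).aemeasurable
  have := Measure.isProbabilityMeasure_map (μ := stdComplexVec κ')
    (measurable_mulVec B).aemeasurable
  refine Measure.ext_of_charFunDual (funext fun L => ?_)
  obtain ⟨c, hc⟩ := exists_strongDual_eq_re_dotProduct L
  rw [charFunDual_map_mulVec_stdComplexVec A L c hc, charFunDual_map_mulVec_stdComplexVec B L c hc,
    h]

theorem stdComplexVec_eq_withDensity (ι : Type*) [Fintype ι] [DecidableEq ι] :
    stdComplexVec ι = volume.withDensity fun x =>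
      ENNReal.ofReal (complexGaussianPDF (0 : ι → ℂ) 1 x) := by
  unfold stdComplexVec stdComplex
  rw [pi_withDensity_ofReal (fun _ => volume) (fun _ => stdComplexPDF)
    (fun _ => stdComplexPDF_nonneg) (fun _ => integrable_stdComplexPDF)]
  congr 1
  ext x
  congr 1
  simp only [stdComplexPDF, complexGaussianPDF, sub_zero, inv_one, Matrix.one_mulVec,
    Matrix.det_one, Complex.one_re, mul_one, Finset.prod_mul_distrib, Finset.prod_const,
    ← Real.exp_sum, Finset.card_univ, inv_pow, dotProduct, Complex.re_sum]
  rw [← Finset.sum_neg_distrib]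
  congr 2
  refine Finset.sum_congr rfl fun i _ => ?_
  rw [Pi.star_apply, Complex.star_def, Complex.conj_mul', ← Complex.ofReal_pow, Complex.ofReal_re]

theorem complexGaussianPDF_nonneg_of_eq {ι κ : Type*} [Fintype ι] [DecidableEq ι] [Fintype κ]
    (m : ι → ℂ) (A : Matrix ι κ ℂ) (y : ι → ℂ) : 0 ≤ complexGaussianPDF m (A * Aᴴ) y := by
  have : 0 ≤ (A * Aᴴ).det.re :=
    (RCLike.nonneg_iff.1 (open ComplexOrder in (Matrix.posSemidef_self_mul_conjTranspose A).det_nonneg)).1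
  unfold complexGaussianPDF
  positivity

theorem continuous_complexGaussianPDF {ι : Type*} [Fintype ι] [DecidableEq ι]
    (m : ι → ℂ) (R : Matrix ι ι ℂ) : Continuous (complexGaussianPDF m R) := by
  have : Continuous fun y : ι → ℂ => star (y - m) ⬝ᵥ (R⁻¹ *ᵥ (y - m)) :=
    Continuous.dotProduct (by fun_prop) (Continuous.matrix_mulVec continuous_const (by fun_prop))
  unfold complexGaussianPDF
  fun_prop

/-- Whitening: `Bᴴ (B Bᴴ)⁻¹ B = 1` turns one exponent into the other, and the factor `‖det B‖²` is
the real Jacobian of a complex linear map. -/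
theorem complexGaussianPDF_affine {ι : Type*} [Fintype ι] [DecidableEq ι]
    (m : ι → ℂ) (B : Matrix ι ι ℂ) (hB : IsUnit B.det) (x : ι → ℂ) :
    complexGaussianPDF 0 1 x =
      ‖B.det‖ ^ 2 * complexGaussianPDF m (B * Bᴴ) (m + B *ᵥ x) := by
  have h1 : (B * Bᴴ).det.re = ‖B.det‖ ^ 2 := by
    rw [Matrix.det_mul, Matrix.det_conjTranspose, Complex.star_def, Complex.mul_conj',
      ← Complex.ofReal_pow, Complex.ofReal_re]
  have hBH : IsUnit Bᴴ.det := by rw [Matrix.det_conjTranspose]; exact hB.star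
  have h2 : Bᴴ * (B * Bᴴ)⁻¹ * B = 1 := by
    rw [Matrix.mul_assoc, Matrix.mul_inv_rev, Matrix.mul_assoc, Matrix.nonsing_inv_mul _ hB, Matrix.mul_one,
      Matrix.mul_nonsing_inv _ hBH]
  have hd : ‖B.det‖ ≠ 0 := norm_ne_zero_iff.2 hB.ne_zero
  unfold complexGaussianPDF
  rw [add_sub_cancel_left, h1, Matrix.star_mulVec, ← Matrix.dotProduct_mulVec,
    Matrix.mulVec_mulVec, Matrix.mulVec_mulVec, h2]
  simp
  field_simp

theorem map_affine_stdComplexVec_of_isUnit {ι : Type*} [Fintype ι] [DecidableEq ι]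
    (m : ι → ℂ) (B : Matrix ι ι ℂ) (hB : IsUnit B.det) :
    (stdComplexVec ι).map (fun x => m + B *ᵥ x) = complexGaussian m (B * Bᴴ) := by
  have hd : 0 < ‖B.det‖ ^ 2 := pow_pos (norm_pos_iff.2 hB.ne_zero) 2
  have hm : Measurable fun x : ι → ℂ => m + B *ᵥ x :=
    (continuous_const.add (Continuous.matrix_mulVec continuous_const continuous_id)).measurable
  have hBm := measurable_mulVec B
  let f : (ι → ℂ) →ₗ[ℝ] (ι → ℂ) := (Matrix.toLin' B).restrictScalars ℝ
  have hdet : LinearMap.det f = ‖B.det‖ ^ 2 := by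
    simp [f, LinearMap.det_restrictScalars, Algebra.norm_complex_eq, Complex.normSq_eq_norm_sq]
  have hvol : (volume : Measure (ι → ℂ)).map (fun x => m + B *ᵥ x) =
      ENNReal.ofReal (‖B.det‖ ^ 2)⁻¹ • volume := by
    have h := Measure.map_linearMap_addHaar_eq_smul_addHaar (volume : Measure (ι → ℂ))
      (f := f) (by rw [hdet]; exact hd.ne')
    rw [hdet, abs_of_pos (inv_pos.2 hd)] at h
    have h' : (volume : Measure (ι → ℂ)).map (fun x => B *ᵥ x) =
      ENNReal.ofReal (‖B.det‖ ^ 2)⁻¹ • volume := h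
    have : (fun x => m + B *ᵥ x) = (fun y => m + y) ∘ fun x => B *ᵥ x := rfl
    rw [this, ← Measure.map_map (measurable_const_add m) hBm, h', Measure.map_smul,
      map_add_left_eq_self]
  -- Lebesgue measure is written as a rescaled image of itself, so that both sides become integrals
  -- in the source variable `x`.
  have hvol' : (volume : Measure (ι → ℂ)) = ENNReal.ofReal (‖B.det‖ ^ 2) •
      (volume : Measure (ι → ℂ)).map (fun x => m + B *ᵥ x) := by
    rw [hvol, smul_smul, ← ENNReal.ofReal_mul hd.le, mul_inv_cancel₀ hd.ne', ENNReal.ofReal_one,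
      one_smul]
  refine Measure.ext fun s hs => ?_
  have hs' : (volume : Measure (ι → ℂ)).restrict s = ENNReal.ofReal (‖B.det‖ ^ 2) •
      ((volume : Measure (ι → ℂ)).map (fun x => m + B *ᵥ x)).restrict s := by
    rw [← Measure.restrict_smul, ← hvol']
  rw [Measure.map_apply hm hs, stdComplexVec_eq_withDensity, withDensity_apply _ (hm hs),
    complexGaussian, withDensity_apply _ hs, hs', lintegral_smul_measure, setLIntegral_map hs
      (continuous_complexGaussianPDF _ _).measurable.ennreal_ofReal hm, smul_eq_mul,
    ← lintegral_const_mul' _ _ ENNReal.ofReal_ne_top]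
  refine lintegral_congr fun x => ?_
  rw [complexGaussianPDF_affine m B hB, ENNReal.ofReal_mul hd.le]

open scoped ComplexOrder MatrixOrder in
theorem exists_mul_conjTranspose_eq_conjTranspose_mul_self {ι κ : Type*} [Fintype ι] [Fintype κ]
    (A : Matrix ι κ ℂ) : ∃ C : Matrix ι ι ℂ, A * Aᴴ = Cᴴ * C := by
  classical
  exact CStarAlgebra.nonneg_iff_eq_star_mul_self.1
    (Matrix.posSemidef_self_mul_conjTranspose A).nonneg

theorem map_affine_eq {ι κ : Type*} [Finite ι] [Fintype κ] (m : ι → ℂ) (A : Matrix ι κ ℂ)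
    (μ : Measure (κ → ℂ)) :
    μ.map (fun x => m + A *ᵥ x) = (μ.map fun x => A *ᵥ x).map fun y => m + y := by
  rw [Measure.map_map (measurable_const_add m) (measurable_mulVec A)]
  rfl

/-- A positive semidefinite `A * Aᴴ` has a square factorization `Cᴴ * C`; its invertibility passes
to `Cᴴ`, and the square case applies. -/
theorem map_affine_stdComplexVec {ι κ : Type*} [Fintype ι] [DecidableEq ι] [Fintype κ]
    (m : ι → ℂ) (A : Matrix ι κ ℂ) (hA : IsUnit (A * Aᴴ).det) :
    (stdComplexVec κ).map (fun x => m + A *ᵥ x) = complexGaussian m (A * Aᴴ) := by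
  obtain ⟨C, hC⟩ : ∃ C : Matrix ι ι ℂ, A * Aᴴ = Cᴴ * C :=
    exists_mul_conjTranspose_eq_conjTranspose_mul_self A
  have hB : A * Aᴴ = Cᴴ * Cᴴᴴ := by rw [Matrix.conjTranspose_conjTranspose, hC]
  have hC' : IsUnit Cᴴ.det := by
    rw [hB, Matrix.det_mul] at hA
    exact isUnit_of_mul_isUnit_left hA
  rw [map_affine_eq, map_mulVec_stdComplexVec_congr A Cᴴ hB, ← map_affine_eq,
    map_affine_stdComplexVec_of_isUnit m _ hC', ← hB]

theorem isProbabilityMeasure_complexGaussian {ι κ : Type*} [Fintype ι] [DecidableEq ι] [Fintype κ]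
    (m : ι → ℂ) (A : Matrix ι κ ℂ) (hA : IsUnit (A * Aᴴ).det) :
    IsProbabilityMeasure (complexGaussian m (A * Aᴴ)) := by
  rw [← map_affine_stdComplexVec m A hA]
  exact Measure.isProbabilityMeasure_map ((measurable_mulVec A).const_add m).aemeasurable

/-! ### Exponential moments -/

theorem memLp_two_of_norm_le_exp {X E : Type*} [NormedAddCommGroup X] [MeasurableSpace X]
    [OpensMeasurableSpace X] [NormedAddCommGroup E]
    {μ : Measure X} (hμ : ∀ C : ℝ, Integrable (fun x => Real.exp (C * ‖x‖)) μ)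
    {f : X → E} (hf : AEStronglyMeasurable f μ) (K C : ℝ)
    (hle : ∀ x, ‖f x‖ ≤ K * Real.exp (C * ‖x‖)) : MemLp f 2 μ := by
  have h : MemLp (fun x => Real.exp (C * ‖x‖)) 2 μ := by
    rw [memLp_two_iff_integrable_sq (hμ C).aestronglyMeasurable]
    refine (hμ (2 * C)).congr (Filter.Eventually.of_forall fun x => ?_)
    simp only [← Real.exp_nat_mul]
    congr 1
    push_cast
    ring
  refine (h.const_mul K).of_le hf (Filter.Eventually.of_forall fun x => ?_)
  exact (hle x).trans (le_abs_self _)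

/-- The sup norm is at most the sum of the norms of the components, so a product of one-variable
exponentials dominates. -/
theorem integrable_exp_mul_norm_pi {τ X : Type*} [Fintype τ] [NormedAddCommGroup X]
    [MeasurableSpace X] [OpensMeasurableSpace X] [SecondCountableTopology X]
    (ν : τ → Measure X) [∀ t, SigmaFinite (ν t)]
    (h : ∀ t (C : ℝ), Integrable (fun x => Real.exp (C * ‖x‖)) (ν t)) (C : ℝ) :
    Integrable (fun x : τ → X => Real.exp (C * ‖x‖)) (Measure.pi ν) := by
  refine (Integrable.fintype_prod (fun t => h t |C|)).mono'
    (by fun_prop) (Filter.Eventually.of_forall fun x => ?_)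
  rw [Real.norm_of_nonneg (Real.exp_nonneg _), ← Real.exp_sum, ← Finset.mul_sum]
  refine Real.exp_le_exp.2 ?_
  have : ‖x‖ ≤ ∑ t, ‖x t‖ := (pi_norm_le_iff_of_nonneg (by positivity)).2 fun t =>
    Finset.single_le_sum (f := fun t => ‖x t‖) (fun _ _ => norm_nonneg _) (Finset.mem_univ t)
  calc C * ‖x‖ ≤ |C| * ‖x‖ := by gcongr; exact le_abs_self C
    _ ≤ _ := by gcongr

theorem integrable_exp_mul_norm_complexGaussian {ι κ : Type*} [Fintype ι] [DecidableEq ι]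
    [Fintype κ] (m : ι → ℂ) (A : Matrix ι κ ℂ) (hA : IsUnit (A * Aᴴ).det) (C : ℝ) :
    Integrable (fun y => Real.exp (C * ‖y‖)) (complexGaussian m (A * Aᴴ)) := by
  let L : (κ → ℂ) →L[ℂ] (ι → ℂ) := A.mulVecLin.toContinuousLinearMap
  have hL : ∀ x, A *ᵥ x = L x := fun x => rfl
  have hm := (measurable_mulVec A).const_add m
  rw [← map_affine_stdComplexVec m A hA, integrable_map_measure (by fun_prop) hm.aemeasurable]
  refine ((integrable_exp_mul_norm_pi (fun _ : κ => stdComplex)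
    (fun _ => integrable_exp_mul_norm_stdComplex) (|C| * ‖L‖)).const_mul
      (Real.exp (|C| * ‖m‖))).mono' ?_ (Filter.Eventually.of_forall fun x => ?_)
  · exact (Real.measurable_exp.comp (measurable_norm.comp hm |>.const_mul C)).aestronglyMeasurable
  · rw [Function.comp_apply, Real.norm_of_nonneg (Real.exp_nonneg _), ← Real.exp_add]
    refine Real.exp_le_exp.2 ?_
    calc C * ‖m + A *ᵥ x‖ ≤ |C| * (‖m‖ + ‖L‖ * ‖x‖) := by
          gcongr
          · exact le_abs_self C
          · exact (norm_add_le _ _).trans (by rw [hL]; gcongr; exact L.le_opNorm x)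
      _ = _ := by ring

/-! ### Second moments -/

/-- Distinct coordinates are independent, so the expectation factors and the centred factor makes it
vanish. This serves both entries of a vector and columns of a matrix. -/
theorem integral_pi_mul_of_integral_eq_zero {τ X : Type*} [Fintype τ] [DecidableEq τ]
    [MeasurableSpace X] (ν : τ → Measure X) [∀ t, IsProbabilityMeasure (ν t)] (f g : τ → X → ℂ)
    (hf : ∀ t, AEStronglyMeasurable (f t) (ν t)) (hg : ∀ t, AEStronglyMeasurable (g t) (ν t))
    (h0 : ∀ t, ∫ x, f t x ∂ν t = 0) (t t' : τ) :
    ∫ x : τ → X, f t (x t) * g t' (x t') ∂Measure.pi ν =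
      if t = t' then ∫ x, f t x * g t x ∂ν t else 0 := by
  split_ifs with htt
  · subst htt
    exact integral_comp_eval (μ := ν) (i := t) (f := fun x => f t x * g t x) ((hf t).mul (hg t))
  · have hind := (iIndepFun_pi (μ := ν) (X := fun _ => id) fun _ => aemeasurable_id).indepFun htt
    have hme : ∀ t, (Measure.pi ν).map (fun x => id (x t)) = ν t := fun t =>
      (measurePreserving_eval ν t).map_eq
    have h := hind.integral_fun_comp_smul_comp (f := f t) (g := g t')
      (measurable_pi_apply t).aemeasurable (measurable_pi_apply t').aemeasurable
      (by rw [hme]; exact hf t) (by rw [hme]; exact hg t')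
    simp only [id, smul_eq_mul] at h
    rw [h, integral_comp_eval (hf t), h0, zero_mul]

theorem memLp_stdComplexVec_apply {κ : Type*} [Fintype κ] (k : κ) :
    MemLp (fun x : κ → ℂ => x k) 2 (stdComplexVec κ) := by
  refine memLp_two_of_norm_le_exp (integrable_exp_mul_norm_pi (fun _ : κ => stdComplex)
    (fun _ => integrable_exp_mul_norm_stdComplex)) (continuous_apply k).aestronglyMeasurable 1 1 fun x => ?_
  rw [one_mul, one_mul]
  have := Real.add_one_le_exp ‖x‖
  linarith [norm_le_pi_norm x k]

theorem integral_stdComplexVec_apply {κ : Type*} [Fintype κ] (k : κ) :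
    ∫ x : κ → ℂ, x k ∂stdComplexVec κ = 0 := by
  rw [← integral_id_stdComplex]
  exact integral_comp_eval (μ := fun _ : κ => stdComplex) (i := k) (f := fun z => z) (by fun_prop)

theorem integral_stdComplexVec_mul_star {κ : Type*} [Fintype κ] [DecidableEq κ] (k l : κ) :
    ∫ x : κ → ℂ, x k * star (x l) ∂stdComplexVec κ = if k = l then 1 else 0 := by
  rw [← integral_mul_star_stdComplex]
  exact integral_pi_mul_of_integral_eq_zero (fun _ : κ => stdComplex) (fun _ z => z)
    (fun _ z => star z) (by fun_prop) (by fun_prop) (fun _ => integral_id_stdComplex) k l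

theorem integral_stdComplexVec_mul {κ : Type*} [Fintype κ] (k l : κ) :
    ∫ x : κ → ℂ, x k * x l ∂stdComplexVec κ = 0 := by
  classical
  refine (integral_pi_mul_of_integral_eq_zero (fun _ : κ => stdComplex) (fun _ z => z)
    (fun _ z => z) (by fun_prop) (by fun_prop) (fun _ => integral_id_stdComplex) k l).trans ?_
  rw [integral_sq_stdComplex, ite_self]

section complexGaussian

variable {ι κ : Type*} [Fintype ι] [DecidableEq ι] [Fintype κ]
  (m : ι → ℂ) (A : Matrix ι κ ℂ) (hA : IsUnit (A * Aᴴ).det)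

include hA

theorem integral_complexGaussian {E : Type*} [NormedAddCommGroup E] [NormedSpace ℝ E]
    {f : (ι → ℂ) → E} (hf : Continuous f) :
    ∫ y, f y ∂complexGaussian m (A * Aᴴ) = ∫ x, f (m + A *ᵥ x) ∂stdComplexVec κ := by
  rw [← map_affine_stdComplexVec m A hA, integral_map ((measurable_mulVec A).const_add m).aemeasurable
    hf.aestronglyMeasurable]

theorem integral_complexGaussian_sub (a : ι) :
    ∫ y, (y a - m a) ∂complexGaussian m (A * Aᴴ) = 0 := by
  rw [integral_complexGaussian m A hA (by fun_prop)]
  simp only [Pi.add_apply, add_sub_cancel_left, Matrix.mulVec, dotProduct]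
  rw [integral_finsetSum _ fun k _ =>
    ((memLp_stdComplexVec_apply k).integrable one_le_two).const_mul _]
  simp only [integral_const_mul, integral_stdComplexVec_apply, mul_zero, Finset.sum_const_zero]

theorem integral_complexGaussian_mul_star (a b : ι) :
    ∫ y, (y a - m a) * star (y b - m b) ∂complexGaussian m (A * Aᴴ) = (A * Aᴴ) a b := by
  classical
  have hi : ∀ k l, Integrable (fun x : κ → ℂ => A a k * star (A b l) * (x k * star (x l)))
      (stdComplexVec κ) := fun k l =>
    ((memLp_stdComplexVec_apply k).integrable_mul (memLp_stdComplexVec_apply l).star).const_mul _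
  rw [integral_complexGaussian m A hA (by fun_prop)]
  have he : ∀ x : κ → ℂ, ((m + A *ᵥ x) a - m a) * star ((m + A *ᵥ x) b - m b) =
      ∑ k, ∑ l, A a k * star (A b l) * (x k * star (x l)) := fun x => by
    simp only [Pi.add_apply, add_sub_cancel_left, Matrix.mulVec, dotProduct, star_sum,
      Finset.sum_mul_sum, star_mul']
    exact Finset.sum_congr rfl fun k _ => Finset.sum_congr rfl fun l _ => by ring
  simp_rw [he]
  rw [integral_finsetSum _ fun k _ => integrable_finsetSum _ fun l _ => hi k l]
  simp_rw [integral_finsetSum _ fun l _ => hi _ l, integral_const_mul,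
    integral_stdComplexVec_mul_star]
  simp [Matrix.mul_apply]

/-- Circular symmetry survives linear maps. This vanishing pseudo-covariance is what makes the
Fisher information depend on `R⁻¹` through a Hermitian form alone. -/
theorem integral_complexGaussian_mul (a b : ι) :
    ∫ y, (y a - m a) * (y b - m b) ∂complexGaussian m (A * Aᴴ) = 0 := by
  have hi : ∀ k l, Integrable (fun x : κ → ℂ => A a k * A b l * (x k * x l))
      (stdComplexVec κ) := fun k l =>
    ((memLp_stdComplexVec_apply k).integrable_mul (memLp_stdComplexVec_apply l)).const_mul _
  rw [integral_complexGaussian m A hA (by fun_prop)]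
  simp only [Pi.add_apply, add_sub_cancel_left, Matrix.mulVec, dotProduct,
    Finset.sum_mul_sum, mul_mul_mul_comm]
  rw [integral_finsetSum _ fun k _ => integrable_finsetSum _ fun l _ => hi k l]
  simp_rw [integral_finsetSum _ fun l _ => hi _ l, integral_const_mul,
    integral_stdComplexVec_mul]
  simp

end complexGaussian

/-! ### Matrices with independent complex Gaussian columns -/

/-- The law of independent complex Gaussian columns with means `m t` and common covariance `R`. -/
def gaussianColumns {τ ι : Type*} [Fintype τ] [Fintype ι] [DecidableEq ι]
    (m : τ → ι → ℂ) (R : Matrix ι ι ℂ) : Measure (τ → ι → ℂ) :=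
  Measure.pi fun t => complexGaussian (m t) R

/-- The density of `gaussianColumns`. -/
def gaussianColumnsPDF {τ ι : Type*} [Fintype τ] [Fintype ι] [DecidableEq ι]
    (m : τ → ι → ℂ) (R : Matrix ι ι ℂ) (y : τ → ι → ℂ) : ℝ :=
  ∏ t, complexGaussianPDF (m t) R (y t)

section gaussianColumns

variable {τ ι κ : Type*} [Fintype τ] [Fintype ι] [DecidableEq ι] [Fintype κ]
  (m : τ → ι → ℂ) (A : Matrix ι κ ℂ) (hA : IsUnit (A * Aᴴ).det)

include hA

theorem isProbabilityMeasure_gaussianColumns : IsProbabilityMeasure (gaussianColumns m (A * Aᴴ)) := by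
  have := fun t => isProbabilityMeasure_complexGaussian (m t) A hA
  unfold gaussianColumns
  infer_instance

theorem gaussianColumns_eq_withDensity : gaussianColumns m (A * Aᴴ) =
    (volume : Measure (τ → ι → ℂ)).withDensity fun y =>
      ENNReal.ofReal (gaussianColumnsPDF m (A * Aᴴ) y) := by
  unfold gaussianColumns complexGaussian
  rw [pi_withDensity_ofReal (fun _ => volume) (fun t => complexGaussianPDF (m t) (A * Aᴴ))
    (fun t => complexGaussianPDF_nonneg_of_eq (m t) A) fun t => ?_]
  · rfl
  have h := isProbabilityMeasure_complexGaussian (m t) A hA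
  refine ⟨(continuous_complexGaussianPDF _ _).aestronglyMeasurable, ?_⟩
  rw [hasFiniteIntegral_iff_ofReal
    (Filter.Eventually.of_forall (complexGaussianPDF_nonneg_of_eq (m t) A))]
  have h1 := h.measure_univ
  rw [complexGaussian, withDensity_apply _ MeasurableSet.univ, Measure.restrict_univ] at h1
  rw [h1]
  exact ENNReal.one_lt_top

theorem integrable_exp_mul_norm_gaussianColumns (C : ℝ) :
    Integrable (fun y => Real.exp (C * ‖y‖)) (gaussianColumns m (A * Aᴴ)) := by
  have := fun t => isProbabilityMeasure_complexGaussian (m t) A hA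
  exact integrable_exp_mul_norm_pi _
    (fun t => integrable_exp_mul_norm_complexGaussian (m t) A hA) C

theorem memLp_gaussianColumns_sub (t : τ) (a : ι) :
    MemLp (fun y => y t a - m t a) 2 (gaussianColumns m (A * Aᴴ)) := by
  have := isProbabilityMeasure_gaussianColumns m A hA
  refine MemLp.sub ?_ (memLp_const _)
  refine memLp_two_of_norm_le_exp (integrable_exp_mul_norm_gaussianColumns m A hA)
    (Continuous.aestronglyMeasurable (by fun_prop)) 1 1 fun x => ?_
  rw [one_mul, one_mul]
  have := Real.add_one_le_exp ‖x‖
  linarith [norm_le_pi_norm x t, norm_le_pi_norm (x t) a]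

theorem integral_gaussianColumns_sub (t : τ) (a : ι) :
    ∫ y, (y t a - m t a) ∂gaussianColumns m (A * Aᴴ) = 0 := by
  have := fun t => isProbabilityMeasure_complexGaussian (m t) A hA
  rw [← integral_complexGaussian_sub (m t) A hA a]
  exact integral_comp_eval (μ := fun t => complexGaussian (m t) (A * Aᴴ)) (i := t)
    (f := fun y => y a - m t a) (Continuous.aestronglyMeasurable (by fun_prop))

theorem integral_gaussianColumns_mul_star [DecidableEq τ] (t t' : τ) (a b : ι) :
    ∫ y, (y t a - m t a) * star (y t' b - m t' b) ∂gaussianColumns m (A * Aᴴ) =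
      if t = t' then (A * Aᴴ) a b else 0 := by
  have := fun t => isProbabilityMeasure_complexGaussian (m t) A hA
  rw [← integral_complexGaussian_mul_star (m t) A hA a b]
  exact integral_pi_mul_of_integral_eq_zero (fun t => complexGaussian (m t) (A * Aᴴ))
    (fun t y => y a - m t a) (fun t y => star (y b - m t b))
    (fun t => Continuous.aestronglyMeasurable (by fun_prop))
    (fun t => (Continuous.star (by fun_prop)).aestronglyMeasurable)
    (fun t => integral_complexGaussian_sub (m t) A hA a) t t'

theorem integral_gaussianColumns_mul (t t' : τ) (a b : ι) :
    ∫ y, (y t a - m t a) * (y t' b - m t' b) ∂gaussianColumns m (A * Aᴴ) = 0 := by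
  classical
  have := fun t => isProbabilityMeasure_complexGaussian (m t) A hA
  refine (integral_pi_mul_of_integral_eq_zero (fun t => complexGaussian (m t) (A * Aᴴ))
    (fun t y => y a - m t a) (fun t y => y b - m t b)
    (fun t => Continuous.aestronglyMeasurable (by fun_prop))
    (fun t => Continuous.aestronglyMeasurable (by fun_prop))
    (fun t => integral_complexGaussian_sub (m t) A hA a) t t').trans ?_
  rw [integral_complexGaussian_mul (m t) A hA a b, ite_self]

end gaussianColumns

/-! ### The Cramér–Rao bound for locally unbiased estimators -/

section cramerRao

variable {κ X : Type*} [Fintype κ] [DecidableEq κ] [MeasurableSpace X]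

theorem integrable_fun_mul_of_memLp {𝕜 : Type*} [RCLike 𝕜] {μ : Measure X} {f g : X → 𝕜}
    (hf : MemLp f 2 μ) (hg : MemLp g 2 μ) : Integrable (fun y => f y * g y) μ :=
  hf.integrable_mul hg

/-- The integral of `(f - g)²` is nonnegative. In the Cramér–Rao bound this replaces Cauchy–Schwarz,
because there `E[f g] = E[g²]`. -/
theorem integral_sq_sub_nonneg_of_memLp {μ : Measure X} {f g : X → ℝ} (hf : MemLp f 2 μ)
    (hg : MemLp g 2 μ) :
    2 * ∫ y, f y * g y ∂μ ≤ (∫ y, f y ^ 2 ∂μ) + ∫ y, g y ^ 2 ∂μ := by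
  rw [← integral_const_mul, ← integral_add hf.integrable_sq hg.integrable_sq]
  refine integral_mono ((integrable_fun_mul_of_memLp hf hg).const_mul 2)
    (hf.integrable_sq.add hg.integrable_sq) fun y => ?_
  dsimp only [Pi.add_apply]
  nlinarith [sq_nonneg (f y - g y)]

/-- Local unbiasedness fixes the inner products of the error with the scores, hence with their span;
the error of least norm under these constraints is the element of the span itself. The optimal
estimator depends on `ζ`, which is admissible since unbiasedness is required only to first order at
`ζ`. -/
theorem cramerRao_isLeast (Q : (κ → ℝ) → Measure X) (ζ : κ → ℝ) [IsProbabilityMeasure (Q ζ)]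
    (s : κ → X → ℝ) (hsm : ∀ i, Measurable (s i)) (hs : ∀ i, MemLp (s i) 2 (Q ζ))
    (hs0 : ∀ i, ∫ y, s i y ∂Q ζ = 0) (J : Matrix κ κ ℝ)
    (hJ : ∀ i j, J i j = ∫ y, s i y * s j y ∂Q ζ)
    (hderiv : ∀ f : X → ℝ, MemLp f 2 (Q ζ) → ∀ j,
      HasDerivAt (fun x : ℝ => ∫ y, f y ∂Q (Function.update ζ j x))
        (∫ y, f y * s j y ∂Q ζ) (ζ j))
    (hu : IsUnit J.det) :
    0 ≤ J⁻¹.trace ∧ IsLeast {e : ℝ | ∃ est, IsLocallyUnbiased Q ζ est ∧ e = rmse Q ζ est}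
      (Real.sqrt J⁻¹.trace) := by
  -- The basis of the span of the scores dual to them: `E[gₖ sⱼ] = δₖⱼ`.
  let g : κ → X → ℝ := fun k y => ∑ j, J⁻¹ k j * s j y
  have hjs : ∀ k j, MemLp (fun y => J⁻¹ k j * s j y) 2 (Q ζ) := fun k j => (hs j).const_mul _
  have hg : ∀ k, MemLp (g k) 2 (Q ζ) := fun k => memLp_finsetSum _ fun j _ => hjs k j
  have hg0 : ∀ k, ∫ y, g k y ∂Q ζ = 0 := fun k => by
    rw [integral_finsetSum _ fun j _ => (hjs k j).integrable one_le_two]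
    simp_rw [integral_const_mul, hs0, mul_zero, Finset.sum_const_zero]
  have hgs : ∀ k j, ∫ y, g k y * s j y ∂Q ζ = if k = j then 1 else 0 := fun k j => by
    simp only [g, Finset.sum_mul, mul_assoc]
    rw [integral_finsetSum _ fun i _ => (integrable_fun_mul_of_memLp (hs i) (hs j)).const_mul _]
    simp_rw [integral_const_mul, ← hJ]
    rw [← Matrix.mul_apply, Matrix.nonsing_inv_mul _ hu, Matrix.one_apply]
  have hfg : ∀ (f : X → ℝ), MemLp f 2 (Q ζ) → ∀ k,
      ∫ y, f y * g k y ∂Q ζ = ∑ j, J⁻¹ k j * ∫ y, f y * s j y ∂Q ζ := fun f hf k => by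
    simp only [g, Finset.mul_sum, mul_left_comm (f _)]
    rw [integral_finsetSum _ fun i _ => (integrable_fun_mul_of_memLp hf (hs i)).const_mul _]
    simp_rw [integral_const_mul]
  have hgg : ∀ k, ∫ y, g k y ^ 2 ∂Q ζ = J⁻¹ k k := fun k => by
    simp_rw [sq]
    rw [hfg _ (hg k)]
    simp [hgs]
  have hrmse : ∀ est : X → κ → ℝ, (∀ k, MemLp (fun y => est y k) 2 (Q ζ)) →
      rmse Q ζ est = Real.sqrt (∑ k, ∫ y, (est y k - ζ k) ^ 2 ∂Q ζ) := fun est h => by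
    have hi : ∀ k, Integrable (fun y => (est y k - ζ k) ^ 2) (Q ζ) := fun k =>
      ((h k).sub (memLp_const (ζ k))).integrable_sq
    rw [rmse, integral_finsetSum _ fun k _ => hi k]
  have hest : ∀ k, MemLp (fun y => ζ k + g k y) 2 (Q ζ) := fun k =>
    (memLp_const (ζ k)).add (hg k)
  refine ⟨Finset.sum_nonneg fun k _ => ?_, ⟨fun y k => ζ k + g k y, ⟨?_, ?_, ?_, ?_⟩, ?_⟩, ?_⟩
  · rw [Matrix.diag_apply, ← hgg]
    exact integral_nonneg fun y => sq_nonneg _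
  · exact measurable_pi_lambda _ fun k => (Finset.measurable_sum _ fun j _ =>
      (hsm j).const_mul _).const_add _
  · exact hest
  · intro k
    rw [integral_add (integrable_const _) ((hg k).integrable one_le_two), hg0]
    simp
  · intro k j
    refine (hderiv _ (hest k) j).congr_deriv ?_
    simp only [add_mul]
    rw [integral_add (((hs j).integrable one_le_two).const_mul _) (integrable_fun_mul_of_memLp (hg k) (hs j)),
      integral_const_mul, hs0, hgs, mul_zero, zero_add]
  · rw [hrmse (fun y k => ζ k + g k y) hest]
    simp_rw [add_sub_cancel_left, hgg]
    rfl
  · rintro e ⟨est, h, rfl⟩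
    rw [hrmse est h.memLp]
    refine Real.sqrt_le_sqrt (Finset.sum_le_sum fun k _ => ?_)
    have he : MemLp (fun y => est y k - ζ k) 2 (Q ζ) := (h.memLp k).sub (memLp_const (ζ k))
    have hes : ∀ j, ∫ y, (est y k - ζ k) * s j y ∂Q ζ = if k = j then 1 else 0 := fun j => by
      simp only [sub_mul]
      rw [integral_sub (integrable_fun_mul_of_memLp (h.memLp k) (hs j))
        (((hs j).integrable one_le_two).const_mul _), integral_const_mul, hs0, mul_zero, sub_zero]
      -- Two values of the same derivative: one from the score, one from local unbiasedness.
      exact (hderiv _ (h.memLp k) j).unique (h.hasDerivAt k j)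
    have := integral_sq_sub_nonneg_of_memLp he (hg k)
    rw [hfg _ he, hgg] at this
    simp_rw [hes, mul_ite, mul_one, mul_zero, Finset.sum_ite_eq, Finset.mem_univ, if_true] at this
    rw [Matrix.diag_apply]
    linarith

end cramerRao

/-! ### The inverse covariance form -/

theorem re_star_dotProduct_comm {ι : Type*} [Fintype ι] (x y : ι → ℂ) : (star x ⬝ᵥ y).re = (star y ⬝ᵥ x).re := by
  rw [← Complex.conj_re, ← Complex.star_def, Matrix.star_dotProduct, star_star, dotProduct_comm]

section colPairing

variable {τ ι κ : Type*} [Fintype τ] [Fintype ι] [DecidableEq ι] [Fintype κ]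

/-- The real bilinear form `∑ t, Re (c_tᴴ R⁻¹ v_t)`. -/
def colPairing (R : Matrix ι ι ℂ) : (τ → ι → ℂ) →L[ℝ] (τ → ι → ℂ) →L[ℝ] ℝ :=
  LinearMap.toContinuousBilinearMap (LinearMap.mk₂ ℝ
    (fun c v : τ → ι → ℂ => ∑ t, (star (c t) ⬝ᵥ (R⁻¹ *ᵥ v t)).re)
    (fun c c' v => by simp [add_dotProduct, Finset.sum_add_distrib])
    (fun r c v => by simp [Finset.mul_sum, star_smul])
    (fun c v v' => by simp [Matrix.mulVec_add, dotProduct_add, Finset.sum_add_distrib])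
    (fun r c v => by simp [Matrix.mulVec_smul, Finset.mul_sum]))

theorem colPairing_apply (R : Matrix ι ι ℂ) (c v : τ → ι → ℂ) :
    colPairing R c v = ∑ t, (star (c t) ⬝ᵥ (R⁻¹ *ᵥ v t)).re := rfl

/-- With `R⁻¹` moved to the fixed argument, the form becomes a plain linear combination of the
entries of `v`, ready for the moment formulas. -/
theorem colPairing_eq_of_isHermitian {R : Matrix ι ι ℂ} (hR : R.IsHermitian) (c v : τ → ι → ℂ) :
    colPairing R c v = ∑ t, (star (R⁻¹ *ᵥ c t) ⬝ᵥ v t).re := by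
  rw [colPairing_apply]
  simp_rw [Matrix.star_mulVec, hR.inv.eq, ← Matrix.dotProduct_mulVec]

theorem colPairing_comm {R : Matrix ι ι ℂ} (hR : R.IsHermitian) (c v : τ → ι → ℂ) :
    colPairing R c v = colPairing R v c := by
  rw [colPairing_eq_of_isHermitian hR, colPairing_apply]
  simp_rw [re_star_dotProduct_comm (R⁻¹ *ᵥ _)]

theorem colPairing_sub_self {R : Matrix ι ι ℂ} (hR : R.IsHermitian) (v d : τ → ι → ℂ) :
    colPairing R (v - d) (v - d) =
      colPairing R v v - (2 * colPairing R d v - colPairing R d d) := by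
  simp only [map_sub, sub_apply, colPairing_comm hR v d]
  ring

theorem gaussianColumnsPDF_eq (m : τ → ι → ℂ) (R : Matrix ι ι ℂ) (y : τ → ι → ℂ) :
    gaussianColumnsPDF m R y = (∏ _t : τ, (Real.pi ^ Fintype.card ι * R.det.re)⁻¹) *
      Real.exp (-colPairing R (y - m) (y - m)) := by
  simp only [gaussianColumnsPDF, complexGaussianPDF, Finset.prod_mul_distrib, colPairing_apply,
    ← Finset.sum_neg_distrib, Real.exp_sum, Pi.sub_apply]

/-- The determinant of a positive semidefinite matrix is real and nonnegative, so being nonzero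
forces its real part to be positive. -/
theorem det_re_pos (A : Matrix ι κ ℂ) (hA : IsUnit (A * Aᴴ).det) : 0 < (A * Aᴴ).det.re := by
  have h : 0 ≤ (A * Aᴴ).det.re ∧ (A * Aᴴ).det.im = 0 :=
    RCLike.nonneg_iff.1
      (open ComplexOrder in (Matrix.posSemidef_self_mul_conjTranspose A).det_nonneg)
  refine lt_of_le_of_ne h.1 fun h0 => hA.ne_zero (Complex.ext h0.symm h.2)

theorem gaussianColumnsPDF_const_pos (A : Matrix ι κ ℂ) (hA : IsUnit (A * Aᴴ).det) :
    0 < ∏ _t : τ, (Real.pi ^ Fintype.card ι * (A * Aᴴ).det.re)⁻¹ := by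
  have := det_re_pos A hA
  exact Finset.prod_pos fun _ _ => by positivity

theorem gaussianColumnsPDF_pos (m : τ → ι → ℂ) (A : Matrix ι κ ℂ) (hA : IsUnit (A * Aᴴ).det)
    (y : τ → ι → ℂ) : 0 < gaussianColumnsPDF m (A * Aᴴ) y := by
  rw [gaussianColumnsPDF_eq]
  exact mul_pos (gaussianColumnsPDF_const_pos A hA) (Real.exp_pos _)

theorem log_gaussianColumnsPDF (m : τ → ι → ℂ) (A : Matrix ι κ ℂ) (hA : IsUnit (A * Aᴴ).det)
    (y : τ → ι → ℂ) : Real.log (gaussianColumnsPDF m (A * Aᴴ) y) =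
      Real.log (∏ _t : τ, (Real.pi ^ Fintype.card ι * (A * Aᴴ).det.re)⁻¹) -
        colPairing (A * Aᴴ) (y - m) (y - m) := by
  rw [gaussianColumnsPDF_eq, Real.log_mul (gaussianColumnsPDF_const_pos A hA).ne'
    (Real.exp_ne_zero _), Real.log_exp, ← sub_eq_add_neg]

theorem hasDerivAt_log_gaussianColumnsPDF (A : Matrix ι κ ℂ) (hA : IsUnit (A * Aᴴ).det)
    (y : τ → ι → ℂ) {M : ℝ → τ → ι → ℂ} {M' : τ → ι → ℂ} {x₀ : ℝ} (hM : HasDerivAt M M' x₀) :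
    HasDerivAt (fun x => Real.log (gaussianColumnsPDF (M x) (A * Aᴴ) y))
      (2 * colPairing (A * Aᴴ) M' (y - M x₀)) x₀ := by
  simp_rw [log_gaussianColumnsPDF _ A hA]
  have hd : HasDerivAt (fun x => y - M x) (-M') x₀ := hM.const_sub y
  have h := ((colPairing (τ := τ) (A * Aᴴ)).hasDerivAt_of_bilinear (fun _ => hd)
    (fun _ => hd)).const_sub
      (Real.log (∏ _t : τ, (Real.pi ^ Fintype.card ι * (A * Aᴴ).det.re)⁻¹))
  refine h.congr_deriv ?_
  rw [colPairing_comm (Matrix.isHermitian_mul_conjTranspose_self A) (y - M x₀)]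
  simp only [map_neg, neg_apply]
  ring

/-- Equal covariances make the normalizations and the terms quadratic in `y` cancel, so the
likelihood ratio is the exponential of an affine function of `y`. -/
theorem gaussianColumnsPDF_tilt (m m' : τ → ι → ℂ) (A : Matrix ι κ ℂ) (y : τ → ι → ℂ) :
    gaussianColumnsPDF m' (A * Aᴴ) y = gaussianColumnsPDF m (A * Aᴴ) y *
      Real.exp (2 * colPairing (A * Aᴴ) (m' - m) (y - m) -
        colPairing (A * Aᴴ) (m' - m) (m' - m)) := by
  rw [gaussianColumnsPDF_eq, gaussianColumnsPDF_eq, mul_assoc, ← Real.exp_add,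
    show y - m' = (y - m) - (m' - m) by abel,
    colPairing_sub_self (Matrix.isHermitian_mul_conjTranspose_self A)]
  congr 2
  ring

theorem continuous_gaussianColumnsPDF (m : τ → ι → ℂ) (R : Matrix ι ι ℂ) :
    Continuous (gaussianColumnsPDF m R) := by
  unfold gaussianColumnsPDF
  exact continuous_finsetProd _ fun t _ =>
    (continuous_complexGaussianPDF (m t) R).comp (continuous_apply t)

theorem integral_gaussianColumns_tilt (m m' : τ → ι → ℂ) (A : Matrix ι κ ℂ)
    (hA : IsUnit (A * Aᴴ).det) (f : (τ → ι → ℂ) → ℝ) :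
    ∫ y, f y ∂gaussianColumns m' (A * Aᴴ) =
      ∫ y, Real.exp (2 * colPairing (A * Aᴴ) (m' - m) (y - m) -
        colPairing (A * Aᴴ) (m' - m) (m' - m)) * f y ∂gaussianColumns m (A * Aᴴ) := by
  have hd : ∀ (m : τ → ι → ℂ) (f : (τ → ι → ℂ) → ℝ), ∫ y, f y ∂gaussianColumns m (A * Aᴴ) =
      ∫ y, gaussianColumnsPDF m (A * Aᴴ) y * f y := fun m f => by
    rw [gaussianColumns_eq_withDensity m A hA, integral_withDensity_eq_integral_toReal_smul
      (continuous_gaussianColumnsPDF _ _).measurable.ennreal_ofReal (by simp)]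
    simp only [ENNReal.toReal_ofReal (gaussianColumnsPDF_pos m A hA _).le, smul_eq_mul]
  rw [hd, hd]
  congr 1 with y
  rw [gaussianColumnsPDF_tilt m m', mul_assoc]

end colPairing

/-! ### Second moments of real linear forms -/

section circular

variable {π X : Type*} [Fintype π] [MeasurableSpace X] {μ : Measure X} {v : π → X → ℂ}

theorem integral_re_sum_eq_zero (hv : ∀ p, Integrable (v p) μ) (h0 : ∀ p, ∫ y, v p y ∂μ = 0)
    (e : π → ℂ) : ∫ y, (∑ p, star (e p) * v p y).re ∂μ = 0 := by
  have hi : ∀ p, Integrable (fun y => star (e p) * v p y) μ := fun p => (hv p).const_mul _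
  have h := integral_re (integrable_finsetSum Finset.univ fun p _ => hi p)
  rw [integral_finsetSum _ fun p _ => hi p] at h
  simp_rw [integral_const_mul, h0, mul_zero, Finset.sum_const_zero] at h
  exact h

/-- From `Re z · Re w = Re (z w̄ + z w) / 2`: the second product has expectation zero by
circularity, and the first gives half of the Hermitian form. -/
theorem integral_re_sum_mul_re_sum (hv : ∀ p, MemLp (v p) 2 μ) (Γ : π → π → ℂ)
    (hΓ : ∀ p q, ∫ y, v p y * star (v q y) ∂μ = Γ p q) (hc : ∀ p q, ∫ y, v p y * v q y ∂μ = 0)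
    (e f : π → ℂ) :
    ∫ y, (∑ p, star (e p) * v p y).re * (∑ q, star (f q) * v q y).re ∂μ =
      (∑ p, ∑ q, star (e p) * f q * Γ p q).re / 2 := by
  have hre : ∀ z w : ℂ, z.re * w.re = ((z * star w + z * w) / 2).re := fun z w => by
    simp [Complex.mul_re]
  have h1 : ∀ p q, Integrable (fun y => star (e p) * f q * (v p y * star (v q y))) μ :=
    fun p q => (integrable_fun_mul_of_memLp (hv p) (hv q).star).const_mul _
  have h2 : ∀ p q, Integrable (fun y => star (e p) * star (f q) * (v p y * v q y)) μ :=
    fun p q => (integrable_fun_mul_of_memLp (hv p) (hv q)).const_mul _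
  have hs1 := integrable_finsetSum Finset.univ fun p _ =>
    integrable_finsetSum Finset.univ fun q _ => h1 p q
  have hs2 := integrable_finsetSum Finset.univ fun p _ =>
    integrable_finsetSum Finset.univ fun q _ => h2 p q
  have hpt : ∀ y, (∑ p, star (e p) * v p y).re * (∑ q, star (f q) * v q y).re =
      (((∑ p, ∑ q, star (e p) * f q * (v p y * star (v q y))) +
        ∑ p, ∑ q, star (e p) * star (f q) * (v p y * v q y)) / 2).re := fun y => by
    rw [hre]
    simp only [star_sum, star_mul', star_star, Finset.sum_mul_sum]
    simp only [mul_mul_mul_comm]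
  simp_rw [hpt]
  have hint := integral_re (𝕜 := ℂ) ((hs1.add hs2).div_const 2)
  refine hint.trans ?_
  simp only [Pi.add_apply]
  rw [integral_div, integral_add hs1 hs2,
    integral_finsetSum _ fun p _ => integrable_finsetSum _ fun q _ => h1 p q,
    integral_finsetSum _ fun p _ => integrable_finsetSum _ fun q _ => h2 p q]
  simp_rw [integral_finsetSum _ fun q _ => h1 _ q, integral_finsetSum _ fun q _ => h2 _ q,
    integral_const_mul, hΓ, hc]
  simp

end circular

theorem abs_exp_sub_one_le_mul_exp (x : ℝ) : |Real.exp x - 1| ≤ |x| * Real.exp |x| := by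
  have h1 := Real.add_one_le_exp x
  have h2 := Real.add_one_le_exp (-x)
  have h3 : Real.exp x * Real.exp (-x) = 1 := by rw [← Real.exp_add]; simp
  have h4 := Real.exp_pos x
  rcases le_total 0 x with hx | hx
  · rw [abs_of_nonneg hx, abs_of_nonneg (by linarith)]
    nlinarith
  · have h5 := Real.one_le_exp (x := -x) (by linarith)
    rw [abs_of_nonpos hx, abs_of_nonpos (by linarith [Real.exp_le_one_iff.2 hx])]
    nlinarith

/-! ### Moments of the Gaussian score -/

section gaussianScore

variable {τ ι κ : Type*} [Fintype τ] [Fintype ι] [DecidableEq ι] [Fintype κ]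
  (m : τ → ι → ℂ) (A : Matrix ι κ ℂ) (hA : IsUnit (A * Aᴴ).det)

theorem colPairing_eq_re_sum (c v : τ → ι → ℂ) : colPairing (A * Aᴴ) c v =
    (∑ p : τ × ι, star (((A * Aᴴ)⁻¹ *ᵥ c p.1) p.2) * v p.1 p.2).re := by
  rw [colPairing_eq_of_isHermitian (Matrix.isHermitian_mul_conjTranspose_self A),
    Fintype.sum_prod_type, Complex.re_sum]
  rfl

include hA

theorem integral_colPairing_sub (c : τ → ι → ℂ) :
    ∫ y, colPairing (A * Aᴴ) c (y - m) ∂gaussianColumns m (A * Aᴴ) = 0 := by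
  have := isProbabilityMeasure_gaussianColumns m A hA
  simp_rw [colPairing_eq_re_sum]
  exact integral_re_sum_eq_zero (v := fun (p : τ × ι) (y : τ → ι → ℂ) => y p.1 p.2 - m p.1 p.2)
    (fun p => (memLp_gaussianColumns_sub m A hA p.1 p.2).integrable one_le_two)
    (fun p => integral_gaussianColumns_sub m A hA p.1 p.2) fun p => ((A * Aᴴ)⁻¹ *ᵥ c p.1) p.2

theorem integral_colPairing_sub_mul (c d : τ → ι → ℂ) :
    ∫ y, colPairing (A * Aᴴ) c (y - m) * colPairing (A * Aᴴ) d (y - m)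
      ∂gaussianColumns m (A * Aᴴ) = colPairing (A * Aᴴ) c d / 2 := by
  classical
  rw [colPairing_eq_re_sum A c d]
  simp_rw [colPairing_eq_re_sum]
  refine (integral_re_sum_mul_re_sum (v := fun (p : τ × ι) (y : τ → ι → ℂ) => y p.1 p.2 - m p.1 p.2)
    (fun p => memLp_gaussianColumns_sub m A hA p.1 p.2)
    (fun p q => if p.1 = q.1 then (A * Aᴴ) p.2 q.2 else 0)
    (fun p q => integral_gaussianColumns_mul_star m A hA p.1 q.1 p.2 q.2)
    (fun p q => integral_gaussianColumns_mul m A hA p.1 q.1 p.2 q.2)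
    (fun p => ((A * Aᴴ)⁻¹ *ᵥ c p.1) p.2) fun p => ((A * Aᴴ)⁻¹ *ᵥ d p.1) p.2).trans ?_
  congr 2
  refine Finset.sum_congr rfl fun p _ => ?_
  -- The coefficients are `R⁻¹ c` and `R⁻¹ d`; the covariance `R` in the double sum cancels one of
  -- the two inverses.
  have hd : d p.1 p.2 = ((A * Aᴴ) *ᵥ ((A * Aᴴ)⁻¹ *ᵥ d p.1)) p.2 := by
    rw [Matrix.mulVec_mulVec, Matrix.mul_nonsing_inv _ hA, Matrix.one_mulVec]
  rw [hd, Fintype.sum_prod_type]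
  simp only [mul_ite, mul_zero]
  rw [Finset.sum_eq_single p.1 (fun t _ ht => Finset.sum_eq_zero fun a _ => if_neg ht.symm)
    (fun h => absurd (Finset.mem_univ _) h)]
  simp only [if_true]
  rw [show ∀ x : ι → ℂ, ((A * Aᴴ) *ᵥ x) p.2 = ∑ a, (A * Aᴴ) p.2 a * x a from fun _ => rfl,
    Finset.mul_sum]
  exact Finset.sum_congr rfl fun a _ => by ring

theorem memLp_colPairing_sub (c : τ → ι → ℂ) :
    MemLp (fun y => colPairing (A * Aᴴ) c (y - m)) 2 (gaussianColumns m (A * Aᴴ)) := by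
  refine memLp_two_of_norm_le_exp (integrable_exp_mul_norm_gaussianColumns m A hA)
    (Continuous.aestronglyMeasurable (by fun_prop))
    (‖colPairing (A * Aᴴ) c‖ * (1 + ‖m‖)) 1 fun y => ?_
  refine ((colPairing (A * Aᴴ) c).le_opNorm _).trans ?_
  rw [mul_assoc, one_mul]
  refine mul_le_mul_of_nonneg_left ?_ (norm_nonneg _)
  have h1 := Real.add_one_le_exp ‖y‖
  have h2 := Real.one_le_exp (norm_nonneg y)
  nlinarith [norm_sub_le y m, norm_nonneg m]

/-! ### Differentiation of expectations with respect to the mean -/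

/-- After tilting, the measure is fixed and only the likelihood ratio varies. As `M` is
differentiable at `x₀` alone, domination rests on a Lipschitz estimate against the value at `x₀`.
The Lipschitz bound is a product of `f` and an exponential, both in `L²`. -/
theorem hasDerivAt_integral_gaussianColumns {M : ℝ → τ → ι → ℂ} {M' : τ → ι → ℂ} {x₀ : ℝ}
    (hM : HasDerivAt M M' x₀) {f : (τ → ι → ℂ) → ℝ}
    (hf : MemLp f 2 (gaussianColumns (M x₀) (A * Aᴴ))) :
    HasDerivAt (fun x => ∫ y, f y ∂gaussianColumns (M x) (A * Aᴴ))
      (∫ y, f y * (2 * colPairing (A * Aᴴ) M' (y - M x₀)) ∂gaussianColumns (M x₀) (A * Aᴴ))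
      x₀ := by
  have := isProbabilityMeasure_gaussianColumns (M x₀) A hA
  set μ := gaussianColumns (M x₀) (A * Aᴴ) with hμ
  set B := colPairing (τ := τ) (A * Aᴴ) with hB
  simp_rw [integral_gaussianColumns_tilt (M x₀) _ A hA f]
  rw [← hμ, ← hB]
  obtain ⟨C, hC0, hC⟩ := hM.hasFDerivAt.isBigO_sub.exists_pos
  have hs : {x : ℝ | ‖M x - M x₀‖ ≤ C * ‖x - x₀‖ ∧ ‖x - x₀‖ ≤ 1} ∈ nhds x₀ := by
    refine Filter.inter_mem hC.bound ?_
    filter_upwards [Metric.closedBall_mem_nhds x₀ one_pos] with x hx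
    rwa [Metric.mem_closedBall, dist_eq_norm] at hx
  -- The summand `2 * C` bounds the linear term of the exponent, and `C ^ 2` the quadratic one,
  -- where one factor `‖x - x₀‖ ≤ 1` is discarded.
  set K := ‖B‖ * (2 * C + C ^ 2) with hK
  have hK0 : 0 ≤ K := by positivity
  let w : (τ → ι → ℂ) → ℝ := fun y => K * (‖y - M x₀‖ + 1)
  have hw0 : ∀ y, 0 ≤ w y := fun y => by positivity
  have hexp : MemLp (fun y => Real.exp (2 * w y)) 2 μ := by
    refine memLp_two_of_norm_le_exp (integrable_exp_mul_norm_gaussianColumns (M x₀) A hA)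
      (Continuous.aestronglyMeasurable (by fun_prop)) (Real.exp (2 * (K * (‖M x₀‖ + 1)))) (2 * K)
      fun y => ?_
    rw [Real.norm_of_nonneg (Real.exp_nonneg _), ← Real.exp_add]
    refine Real.exp_le_exp.2 ?_
    have := mul_le_mul_of_nonneg_left (norm_sub_le y (M x₀)) hK0
    simp only [w]
    nlinarith
  have hℓ : ∀ y x, ‖M x - M x₀‖ ≤ C * ‖x - x₀‖ → ‖x - x₀‖ ≤ 1 →
      |2 * B (M x - M x₀) (y - M x₀) - B (M x - M x₀) (M x - M x₀)| ≤ ‖x - x₀‖ * w y := by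
    intro y x h1 h2
    have hn := norm_nonneg (x - x₀)
    have hb1 : |B (M x - M x₀) (y - M x₀)| ≤ ‖B‖ * (C * ‖x - x₀‖) * ‖y - M x₀‖ :=
      (B.le_opNorm₂ _ _).trans (by gcongr)
    have hb2 : |B (M x - M x₀) (M x - M x₀)| ≤ ‖B‖ * (C * ‖x - x₀‖) * (C * ‖x - x₀‖) :=
      (B.le_opNorm₂ _ _).trans (by gcongr)
    have hb3 : ‖B‖ * (C * ‖x - x₀‖) * (C * ‖x - x₀‖) ≤ ‖B‖ * C ^ 2 * ‖x - x₀‖ := by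
      have : ‖x - x₀‖ * ‖x - x₀‖ ≤ ‖x - x₀‖ := mul_le_of_le_one_left hn h2
      calc _ = ‖B‖ * C ^ 2 * (‖x - x₀‖ * ‖x - x₀‖) := by ring
        _ ≤ _ := by gcongr
    calc _ ≤ 2 * |B (M x - M x₀) (y - M x₀)| + |B (M x - M x₀) (M x - M x₀)| := by
          refine (abs_sub _ _).trans ?_
          rw [abs_mul, abs_two]
      _ ≤ 2 * (‖B‖ * (C * ‖x - x₀‖) * ‖y - M x₀‖) + ‖B‖ * C ^ 2 * ‖x - x₀‖ := by linarith
      _ ≤ ‖x - x₀‖ * w y := by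
          simp only [w, hK]
          have h5 : 0 ≤ ‖B‖ * C * ‖x - x₀‖ := by positivity
          have h6 : 0 ≤ ‖B‖ * C ^ 2 * ‖x - x₀‖ * ‖y - M x₀‖ := by positivity
          nlinarith
  have key := hasFDerivAt_integral_of_dominated_loc_of_lip' (𝕜 := ℝ) (μ := μ) (x₀ := x₀)
    (F := fun x y => Real.exp (2 * B (M x - M x₀) (y - M x₀) -
      B (M x - M x₀) (M x - M x₀)) * f y)
    (F' := fun y => ContinuousLinearMap.toSpanSingleton ℝ (f y * (2 * B M' (y - M x₀))))
    (bound := fun y => Real.exp (2 * w y) * |f y|) hs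
    (fun x _ => (Continuous.aestronglyMeasurable (by fun_prop)).mul hf.aestronglyMeasurable)
    ?_ ?_ ?_ (integrable_fun_mul_of_memLp hexp hf.abs) ?_
  · obtain ⟨hi, hd⟩ := key
    have h := hd.hasDerivAt
    rw [ContinuousLinearMap.integral_apply hi] at h
    simpa using h
  · simpa using hf.integrable one_le_two
  · exact (ContinuousLinearMap.toSpanSingletonCLE (𝕜 := ℝ) (E := ℝ)).continuous.comp_aestronglyMeasurable
      (hf.aestronglyMeasurable.mul (Continuous.aestronglyMeasurable (by fun_prop)))
  · refine Filter.Eventually.of_forall fun y x hx => ?_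
    -- At `x₀` the tilt equals `1`, so the increment is `(exp ℓ - 1) * f y` with `|ℓ| ≤ ‖x - x₀‖ * w
    -- y`.
    simp only [sub_self, map_zero, mul_zero, Real.exp_zero, one_mul, zero_apply]
    rw [← sub_one_mul, norm_mul, Real.norm_eq_abs, Real.norm_eq_abs (f y)]
    have h1 := hℓ y x hx.1 hx.2
    have h2 : ‖x - x₀‖ * w y ≤ w y := mul_le_of_le_one_left (hw0 y) hx.2
    set ℓ := 2 * B (M x - M x₀) (y - M x₀) - B (M x - M x₀) (M x - M x₀)
    calc |Real.exp ℓ - 1| * |f y| ≤ (|ℓ| * Real.exp |ℓ|) * |f y| := by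
          gcongr; exact abs_exp_sub_one_le_mul_exp ℓ
      _ ≤ ((‖x - x₀‖ * w y) * Real.exp (w y)) * |f y| := by gcongr; exact h1.trans h2
      _ ≤ ((‖x - x₀‖ * Real.exp (w y)) * Real.exp (w y)) * |f y| := by
          gcongr
          linarith [Real.add_one_le_exp (w y)]
      _ = Real.exp (2 * w y) * |f y| * ‖x - x₀‖ := by
          rw [two_mul, Real.exp_add]; ring
  · refine Filter.Eventually.of_forall fun y => ?_
    have hd : HasDerivAt (fun x => M x - M x₀) M' x₀ := hM.sub_const _
    have h1 : HasDerivAt (fun x => B (M x - M x₀) (y - M x₀)) (B M' (y - M x₀)) x₀ :=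
      ((B.flip (y - M x₀)).hasFDerivAt.comp_hasDerivAt x₀ hd)
    have h2 := B.hasDerivAt_of_bilinear (fun _ => hd) (fun _ => hd)
    have h3 := (((h1.const_mul 2).sub h2).exp.mul_const (f y)).hasFDerivAt
    refine h3.congr_fderiv ?_
    simp [mul_comm]

end gaussianScore

/-! ### Partial derivatives -/

theorem DifferentiableAt.hasDerivAt_partialDeriv {κ E : Type*} [Fintype κ] [DecidableEq κ]
    [NormedAddCommGroup E] [NormedSpace ℝ E] {f : (κ → ℝ) → E} {ζ : κ → ℝ}
    (hf : DifferentiableAt ℝ f ζ) (i : κ) :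
    HasDerivAt (fun x : ℝ => f (Function.update ζ i x)) (partialDeriv f i ζ) (ζ i) := by
  have hf' : DifferentiableAt ℝ f (Function.update ζ i (ζ i)) := by
    rwa [Function.update_eq_self]
  exact (hf'.comp (ζ i) (hasDerivAt_update ζ i (ζ i)).differentiableAt).hasDerivAt

theorem matPartialDeriv_conjTranspose {κ m n : Type*} [DecidableEq κ]
    (A : (κ → ℝ) → Matrix m n ℂ) (i : κ) (ζ : κ → ℝ) :
    matPartialDeriv (fun z => (A z)ᴴ) i ζ = (matPartialDeriv A i ζ)ᴴ := by
  ext a b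
  simp only [matPartialDeriv, partialDeriv, Matrix.of_apply, Matrix.conjTranspose_apply]
  exact deriv.star

theorem hasDerivAt_matrix_mul_const {l m n o : Type*} [Fintype m] [Fintype n]
    (C : Matrix l m ℂ) (D : Matrix n o ℂ) {G : ℝ → Matrix m n ℂ} {G' : Matrix m n ℂ} {x₀ : ℝ}
    (hG : ∀ a b, HasDerivAt (fun x => G x a b) (G' a b) x₀) (a : l) (b : o) :
    HasDerivAt (fun x => (C * (G x * D)) a b) ((C * (G' * D)) a b) x₀ := by
  simp only [Matrix.mul_apply]
  exact HasDerivAt.fun_sum fun i _ => (HasDerivAt.fun_sum fun j _ =>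
    (hG i j).mul_const (D j b)).const_mul (C a i)

/-! ### Linear images of complex Gaussian vectors -/

theorem hasLaw_affine_complexGaussian {Ω ι κ : Type*} [MeasurableSpace Ω] {μ : Measure Ω}
    [Fintype ι] [DecidableEq ι] [Fintype κ] [DecidableEq κ] {X : Ω → κ → ℂ} {σ : ℝ} (hσ : 0 < σ)
    (hX : HasLaw X (complexGaussian 0 (((σ : ℂ) ^ 2) • 1)) μ) (m : ι → ℂ) (A : Matrix ι κ ℂ)
    (hA : IsUnit (((σ : ℂ) • A) * ((σ : ℂ) • A)ᴴ).det) :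
    HasLaw (fun ω => m + A *ᵥ X ω) (complexGaussian m (((σ : ℂ) • A) * ((σ : ℂ) • A)ᴴ)) μ := by
  have hmm := (measurable_mulVec A).const_add m
  refine ⟨hmm.comp_aemeasurable hX.aemeasurable, ?_⟩
  -- The noise itself is a linear image of the standard vector, so the whole map is a composition of
  -- two affine maps applied to it.
  have h1 : (((σ : ℂ) ^ 2) • 1 : Matrix κ κ ℂ) = ((σ : ℂ) • 1) * ((σ : ℂ) • 1)ᴴ := by
    rw [Matrix.conjTranspose_smul, Complex.star_def, Complex.conj_ofReal, smul_mul_smul_comm,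
      Matrix.conjTranspose_one, mul_one, sq]
  have h2 : IsUnit (((σ : ℂ) • 1 : Matrix κ κ ℂ) * ((σ : ℂ) • 1)ᴴ).det := by
    rw [← h1, Matrix.det_smul, Matrix.det_one, mul_one]
    have : (σ : ℂ) ≠ 0 := by exact_mod_cast hσ.ne'
    exact (pow_ne_zero _ (pow_ne_zero 2 this)).isUnit
  have hc : (fun ω => m + A *ᵥ X ω) = (fun x => m + A *ᵥ x) ∘ X := rfl
  rw [hc, ← AEMeasurable.map_map_of_aemeasurable hmm.aemeasurable hX.aemeasurable, hX.map_eq, h1,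
    ← map_affine_stdComplexVec 0 _ h2, ← map_affine_stdComplexVec m _ hA,
    Measure.map_map hmm ((measurable_mulVec _).const_add 0)]
  congr 1
  ext x a
  simp [Matrix.smul_mulVec, Matrix.mulVec_smul]

/-! ### The receiver as a Gaussian model -/

namespace DMASystem

variable {NRF NE U T : ℕ} (S : DMASystem NRF NE U T)

/-- The columns of the mean of the received signal. -/
def meanCol (z : Fin U × Fin 3 → ℝ) : Fin T → Fin NRF → ℂ := fun t a => S.mean z a t

/-- A matrix factor of the covariance: `R_n = C Cᴴ`. -/
def covFactor : Matrix (Fin NRF) (Fin NRF × Fin NE) ℂ := (S.sigma : ℂ) • (S.Wᴴ * S.Pᴴ)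

theorem noiseCov_eq : S.noiseCov = S.covFactor * S.covFactorᴴ := by
  rw [noiseCov, covFactor, Matrix.conjTranspose_smul, Complex.star_def, Complex.conj_ofReal,
    Matrix.smul_mul, Matrix.mul_smul, smul_smul, Matrix.conjTranspose_mul, Matrix.conjTranspose_conjTranspose,
    Matrix.conjTranspose_conjTranspose, sq]
  simp only [Matrix.mul_assoc]

theorem obsLaw_eq (z : Fin U × Fin 3 → ℝ) :
    S.obsLaw z = gaussianColumns (S.meanCol z) (S.covFactor * S.covFactorᴴ) := by
  rw [← noiseCov_eq]; rfl

theorem likelihood_eq (z : Fin U × Fin 3 → ℝ) (y : Fin T → Fin NRF → ℂ) : S.likelihood z y =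
    gaussianColumnsPDF (S.meanCol z) (S.covFactor * S.covFactorᴴ) y := by
  rw [← noiseCov_eq]; rfl

section law

variable {S} (hsigma : 0 < S.sigma) (hR : IsUnit (S.covFactor * S.covFactorᴴ).det)
  {Ω : Type*} [MeasurableSpace Ω] {μ : Measure Ω} [IsProbabilityMeasure μ]
  {N : Ω → Matrix (Fin NRF × Fin NE) (Fin T) ℂ}
  (hindep : iIndepFun (fun (t : Fin T) (ω : Ω) (a : Fin NRF × Fin NE) => N ω a t) μ)
  (hN : ∀ t : Fin T, HasLaw (fun (ω : Ω) (a : Fin NRF × Fin NE) => N ω a t)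
      (complexGaussian 0 (((S.sigma : ℂ) ^ 2) • 1)) μ)

include hsigma hR hindep hN

theorem hasLaw_received (z : Fin U × Fin 3 → ℝ) :
    HasLaw (fun (ω : Ω) (t : Fin T) (a : Fin NRF) => S.received z (N ω) a t) (S.obsLaw z) μ := by
  have hcol : ∀ t, HasLaw (fun ω a => S.received z (N ω) a t)
      (complexGaussian (S.meanCol z t) (S.covFactor * S.covFactorᴴ)) μ := fun t =>
    hasLaw_affine_complexGaussian hsigma (hN t) (S.meanCol z t) (S.Wᴴ * S.Pᴴ) hR
  have hi : iIndepFun (fun (t : Fin T) (ω : Ω) (a : Fin NRF) => S.received z (N ω) a t) μ :=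
    hindep.comp (fun t x => S.meanCol z t + (S.Wᴴ * S.Pᴴ) *ᵥ x)
      fun t => (measurable_mulVec _).const_add _
  refine ⟨aemeasurable_pi_lambda _ fun t => (hcol t).aemeasurable, ?_⟩
  rw [obsLaw_eq, (iIndepFun_iff_map_fun_eq_pi_map fun t => (hcol t).aemeasurable).1 hi]
  simp_rw [fun t => (hcol t).map_eq]
  rfl

theorem memLp_received (z : Fin U × Fin 3 → ℝ) (a : Fin NRF) (t : Fin T) :
    MemLp (fun ω => S.received z (N ω) a t) 2 μ := by
  have h := hasLaw_received hsigma hR hindep hN z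
  have hm : MemLp (fun y => (y t a - S.meanCol z t a) + S.meanCol z t a) 2 (S.obsLaw z) := by
    have := isProbabilityMeasure_gaussianColumns (S.meanCol z) S.covFactor hR
    rw [obsLaw_eq]
    exact (memLp_gaussianColumns_sub (S.meanCol z) S.covFactor hR t a).add (memLp_const _)
  simp only [sub_add_cancel] at hm
  rw [← h.map_eq] at hm
  exact hm.comp_of_map h.aemeasurable

theorem integral_received_comp {f : (Fin T → Fin NRF → ℂ) → ℂ} (hf : Continuous f)
    (z : Fin U × Fin 3 → ℝ) :
    ∫ ω, f (fun t a => S.received z (N ω) a t) ∂μ =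
      ∫ y, f y ∂gaussianColumns (S.meanCol z) (S.covFactor * S.covFactorᴴ) := by
  have h := hasLaw_received hsigma hR hindep hN z
  rw [← obsLaw_eq, ← h.map_eq, integral_map h.aemeasurable hf.aestronglyMeasurable]

theorem integral_received (z : Fin U × Fin 3 → ℝ) (a : Fin NRF) (t : Fin T) :
    ∫ ω, S.received z (N ω) a t ∂μ = S.mean z a t := by
  have h := integral_received_comp hsigma hR hindep hN
    (f := fun y => y t a - S.meanCol z t a) (by fun_prop) z
  rw [integral_gaussianColumns_sub _ _ hR, integral_sub
    ((memLp_received hsigma hR hindep hN z a t).integrable one_le_two) (integrable_const _)] at h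
  simpa [sub_eq_zero, meanCol] using h

theorem integral_received_mul_star (z : Fin U × Fin 3 → ℝ) (a a' : Fin NRF) (t t' : Fin T) :
    ∫ ω, (S.received z (N ω) a t - S.mean z a t) *
          star (S.received z (N ω) a' t' - S.mean z a' t') ∂μ
        = if t = t' then S.noiseCov a a' else 0 := by
  rw [noiseCov_eq, ← integral_gaussianColumns_mul_star (S.meanCol z) S.covFactor hR]
  exact integral_received_comp hsigma hR hindep hN
    (f := fun y => (y t a - S.meanCol z t a) * star (y t' a' - S.meanCol z t' a')) (by fun_prop) z

end law

/-! ### Differentiability of the channel -/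

/-- This quantity serves twice: it keeps the distance positive, and it keeps the elevation angle
away from `π/2`, where the radiation profile may fail to be smooth. -/
theorem horizontal_dist_sq_pos {ζ : Fin U × Fin 3 → ℝ} (hζ : S.OffMicrostripLines ζ) (u : Fin U)
    (a : Fin NRF × Fin NE) :
    0 < (xPos ζ u - (a.1 : ℕ) * S.dRF) ^ 2 + (yPos ζ u) ^ 2 := by
  rcases hζ u a.1 with h | h
  · have := sub_ne_zero.2 h
    positivity
  · positivity

theorem differentiableAt_dist {ζ : Fin U × Fin 3 → ℝ} (hζ : S.OffMicrostripLines ζ) (u : Fin U)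
    (a : Fin NRF × Fin NE) : DifferentiableAt ℝ (fun z => S.dist z u a) ζ := by
  have := S.horizontal_dist_sq_pos hζ u a
  unfold dist
  refine DifferentiableAt.sqrt ?_ (by positivity)
  unfold xPos yPos zPos
  fun_prop

/-- An arcsine always lies in the range of the cutoff, and `cos (arcsin x) = √(1 - x²)` squares away
the absolute value, so equal heights of user and metamaterial cause no kink. -/
theorem differentiableAt_sqrt_radiation {ζ : Fin U × Fin 3 → ℝ} (hζ : S.OffMicrostripLines ζ)
    (u : Fin U) (a : Fin NRF × Fin NE) :
    DifferentiableAt ℝ (fun z => Real.sqrt (S.radiation (S.elev z u a))) ζ := by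
  have hr : ∀ z, S.radiation (S.elev z u a) = 2 * (S.b + 1) *
      Real.sqrt (1 - ((S.dist z u a)⁻¹ * ((a.2 : ℕ) * S.dE - zPos z u)) ^ 2) ^ S.b := fun z => by
    rw [radiation, if_pos (by exact Real.arcsin_mem_Icc _), elev, Real.cos_arcsin, mul_pow, sq_abs,
      ← mul_pow]
  simp_rw [hr]
  -- For `b ≤ -1` the profile is nonpositive and `Real.sqrt` returns `0`, so the function is
  -- constant.
  rcases le_or_gt (2 * (S.b + 1)) 0 with hb | hb
  · have : ∀ z : Fin U × Fin 3 → ℝ, Real.sqrt (2 * (S.b + 1) *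
        Real.sqrt (1 - ((S.dist z u a)⁻¹ * ((a.2 : ℕ) * S.dE - zPos z u)) ^ 2) ^ S.b) = 0 :=
      fun z => Real.sqrt_eq_zero_of_nonpos
        (mul_nonpos_of_nonpos_of_nonneg hb (Real.rpow_nonneg (Real.sqrt_nonneg _) _))
    simp_rw [this]
    exact differentiableAt_const 0
  · have hp := S.horizontal_dist_sq_pos hζ u a
    have hd : 0 < S.dist ζ u a := Real.sqrt_pos.2 (by positivity)
    have hd2 : S.dist ζ u a ^ 2 = (xPos ζ u - (a.1 : ℕ) * S.dRF) ^ 2 + (yPos ζ u) ^ 2 +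
        (zPos ζ u - (a.2 : ℕ) * S.dE) ^ 2 := Real.sq_sqrt (by positivity)
    -- The cosine of the elevation is strictly positive off the line, so its real power is
    -- differentiable for every exponent `b`.
    have h1 : 0 < 1 - ((S.dist ζ u a)⁻¹ * ((a.2 : ℕ) * S.dE - zPos ζ u)) ^ 2 := by
      rw [mul_pow, inv_pow, sub_pos, inv_mul_lt_iff₀ (by positivity), hd2]
      nlinarith
    have h2 : 0 < Real.sqrt (1 - ((S.dist ζ u a)⁻¹ * ((a.2 : ℕ) * S.dE - zPos ζ u)) ^ 2) :=
      Real.sqrt_pos.2 h1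
    have hz : DifferentiableAt ℝ (fun z => (a.2 : ℕ) * S.dE - zPos z u) ζ := by
      unfold zPos; fun_prop
    refine DifferentiableAt.sqrt ?_ (mul_pos hb (Real.rpow_pos_of_pos h2 _)).ne'
    have hq : DifferentiableAt ℝ
        (fun z => 1 - ((S.dist z u a)⁻¹ * ((a.2 : ℕ) * S.dE - zPos z u)) ^ 2) ζ :=
      ((((S.differentiableAt_dist hζ u a).inv hd.ne').mul hz).pow 2).const_sub 1
    exact ((hq.sqrt h1.ne').rpow_const (Or.inl h2.ne')).const_mul (2 * (S.b + 1))

theorem differentiableAt_h {ζ : Fin U × Fin 3 → ℝ} (hζ : S.OffMicrostripLines ζ) (u : Fin U)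
    (a : Fin NRF × Fin NE) : DifferentiableAt ℝ (fun z => S.h z u () a) ζ := by
  have hp := S.horizontal_dist_sq_pos hζ u a
  have hd : 0 < S.dist ζ u a := Real.sqrt_pos.2 (by positivity)
  have hD := S.differentiableAt_dist hζ u a
  have hne : 4 * Real.pi * S.dist ζ u a ≠ 0 := by positivity
  have hatt : DifferentiableAt ℝ (fun z => S.atten z u a) ζ := by
    unfold atten
    have h0 : DifferentiableAt ℝ (fun z => 4 * Real.pi * S.dist z u a) ζ := hD.const_mul _
    have h1 : DifferentiableAt ℝ (fun z => S.lam / (4 * Real.pi * S.dist z u a)) ζ :=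
      (h0.fun_inv hne).const_mul S.lam
    have h2 : DifferentiableAt ℝ (fun z => -(S.kabs * S.dist z u a) / 2) ζ := by fun_prop
    exact ((S.differentiableAt_sqrt_radiation hζ u a).mul h1).mul h2.exp
  have hph : DifferentiableAt ℝ (fun z => 2 * Real.pi / S.lam * S.dist z u a) ζ := hD.const_mul _
  have hofReal : ∀ {g : (Fin U × Fin 3 → ℝ) → ℝ}, DifferentiableAt ℝ g ζ →
      DifferentiableAt ℝ (fun z => (g z : ℂ)) ζ := fun hg =>
    Complex.ofRealCLM.differentiableAt.comp ζ hg
  exact (hofReal hatt).mul ((hofReal hph).const_mul Complex.I).cexp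

end DMASystem

namespace DMASystem

variable {NRF NE U T : ℕ} (S : DMASystem NRF NE U T)

/-! ### Derivatives of the mean -/

theorem differentiableAt_meanCol {ζ : Fin U × Fin 3 → ℝ} (hζ : S.OffMicrostripLines ζ) :
    DifferentiableAt ℝ S.meanCol ζ := by
  refine differentiableAt_pi.2 fun t => differentiableAt_pi.2 fun a => ?_
  simp only [meanCol, mean, Matrix.mul_apply (M := S.Wᴴ * S.Pᴴ), Matrix.sum_apply,
    Matrix.mul_apply (N := S.s _), Matrix.conjTranspose_apply]
  exact DifferentiableAt.fun_sum fun b _ => (DifferentiableAt.fun_sum fun u _ =>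
    DifferentiableAt.fun_sum fun c _ =>
      (S.differentiableAt_h hζ u b).star.mul_const _).const_mul _

theorem hasDerivAt_meanCol {ζ : Fin U × Fin 3 → ℝ} (hζ : S.OffMicrostripLines ζ)
    (i : Fin U × Fin 3) :
    HasDerivAt (fun x : ℝ => S.meanCol (Function.update ζ i x))
      (fun t a => matPartialDeriv S.mean i ζ a t) (ζ i) :=
  hasDerivAt_pi.2 fun t => hasDerivAt_pi.2 fun a =>
    (differentiableAt_pi.1 (differentiableAt_pi.1 (S.differentiableAt_meanCol hζ) t)
      a).hasDerivAt_partialDeriv i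

theorem matPartialDeriv_mean {ζ : Fin U × Fin 3 → ℝ} (hζ : S.OffMicrostripLines ζ)
    (i : Fin U × Fin 3) : matPartialDeriv S.mean i ζ =
      S.Wᴴ * S.Pᴴ * ∑ u, matPartialDeriv (fun z => (S.h z u)ᴴ) i ζ * S.s u := by
  ext a t
  have h : ∀ u, HasDerivAt (fun x => ((S.Wᴴ * S.Pᴴ) *
      ((S.h (Function.update ζ i x) u)ᴴ * S.s u)) a t)
      (((S.Wᴴ * S.Pᴴ) * (matPartialDeriv (fun z => (S.h z u)ᴴ) i ζ * S.s u)) a t) (ζ i) :=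
    fun u => hasDerivAt_matrix_mul_const _ _ (fun b c =>
      (S.differentiableAt_h hζ u b).star.hasDerivAt_partialDeriv i) a t
  have hs := HasDerivAt.fun_sum (u := Finset.univ) fun u _ => h u
  simp only [← Matrix.sum_apply, ← Matrix.mul_sum] at hs
  exact hs.deriv

/-- The channel of a user involves the coordinates of that user only. This removes the cross terms
between users from the diagonal entries. -/
theorem matPartialDeriv_h_eq_zero (ζ : Fin U × Fin 3 → ℝ) {i : Fin U × Fin 3} {u : Fin U}
    (hu : u ≠ i.1) : matPartialDeriv (fun z => S.h z u) i ζ = 0 := by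
  have hup : ∀ (x : ℝ) (k : Fin 3), Function.update ζ i x (u, k) = ζ (u, k) := fun x k =>
    Function.update_of_ne (fun h => hu (congrArg Prod.fst h)) _ _
  ext c a
  have hc : ∀ x : ℝ, S.h (Function.update ζ i x) u c a = S.h ζ u c a := fun x => by
    simp only [h, atten, elev, dist, xPos, yPos, zPos, hup, Matrix.of_apply]
  simp only [matPartialDeriv, partialDeriv, Matrix.of_apply, hc, deriv_const, Matrix.zero_apply]

theorem matPartialDeriv_mean_eq_single {ζ : Fin U × Fin 3 → ℝ} (hζ : S.OffMicrostripLines ζ)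
    (i : Fin U × Fin 3) : matPartialDeriv S.mean i ζ =
      S.Wᴴ * S.Pᴴ * ((matPartialDeriv (fun z => S.h z i.1) i ζ)ᴴ * S.s i.1) := by
  rw [S.matPartialDeriv_mean hζ]
  simp only [matPartialDeriv_conjTranspose]
  rw [Finset.sum_eq_single i.1 (fun u _ hu => by rw [S.matPartialDeriv_h_eq_zero ζ hu]; simp)
    fun h => absurd (Finset.mem_univ _) h]

theorem matPartialDeriv_mean_quadratic {ζ : Fin U × Fin 3 → ℝ} (hζ : S.OffMicrostripLines ζ)
    (i : Fin U × Fin 3) :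
    (matPartialDeriv S.mean i ζ)ᴴ * S.noiseCov⁻¹ * matPartialDeriv S.mean i ζ =
      (S.s i.1)ᴴ * matPartialDeriv (fun z => S.h z i.1) i ζ * S.P * S.F * S.Pᴴ *
        matPartialDeriv (fun z => (S.h z i.1)ᴴ) i ζ * S.s i.1 := by
  rw [S.matPartialDeriv_mean_eq_single hζ, matPartialDeriv_conjTranspose, F]
  simp only [Matrix.conjTranspose_mul, Matrix.conjTranspose_conjTranspose, Matrix.mul_assoc]

/-- The map `f` is left general so as to cover both the entrywise real part and the real part of the
trace. -/
theorem sum_eq_single_user {E : Type*} [AddCommMonoid E] (ζ : Fin U × Fin 3 → ℝ)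
    (i : Fin U × Fin 3) (f : Matrix (Fin T) (Fin T) ℂ → E) (hf : f 0 = 0) :
    ∑ u, f ((S.s u)ᴴ * matPartialDeriv (fun z => S.h z u) i ζ * S.P * S.F * S.Pᴴ *
        matPartialDeriv (fun z => (S.h z u)ᴴ) i ζ * S.s u) =
      f ((S.s i.1)ᴴ * matPartialDeriv (fun z => S.h z i.1) i ζ * S.P * S.F * S.Pᴴ *
        matPartialDeriv (fun z => (S.h z i.1)ᴴ) i ζ * S.s i.1) := by
  refine Finset.sum_eq_single i.1 (fun u _ hu => ?_) fun h => absurd (Finset.mem_univ _) h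
  rw [S.matPartialDeriv_h_eq_zero ζ hu]
  simpa using hf

/-! ### The Fisher information -/

variable {S} (hR : IsUnit (S.covFactor * S.covFactorᴴ).det) {ζ : Fin U × Fin 3 → ℝ}
  (hζ : S.OffMicrostripLines ζ)

include hR hζ

theorem differentiableAt_log_likelihood (y : Fin T → Fin NRF → ℂ) :
    DifferentiableAt ℝ (fun z => Real.log (S.likelihood z y)) ζ := by
  simp_rw [likelihood_eq, log_gaussianColumnsPDF _ _ hR]
  have hd : DifferentiableAt ℝ (fun z => y - S.meanCol z) ζ :=
    (S.differentiableAt_meanCol hζ).const_sub y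
  exact (((colPairing (S.covFactor * S.covFactorᴴ)).hasFDerivAt_of_bilinear
    hd.hasFDerivAt hd.hasFDerivAt).differentiableAt).const_sub _

theorem score_likelihood (i : Fin U × Fin 3) (y : Fin T → Fin NRF → ℂ) :
    score S.likelihood ζ i y = 2 * colPairing (S.covFactor * S.covFactorᴴ)
      (fun t a => matPartialDeriv S.mean i ζ a t) (y - S.meanCol ζ) := by
  have h := hasDerivAt_log_gaussianColumnsPDF S.covFactor hR y (S.hasDerivAt_meanCol hζ i)
  rw [Function.update_eq_self] at h
  simp_rw [← likelihood_eq] at h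
  exact h.deriv

theorem memLp_score (i : Fin U × Fin 3) :
    MemLp (fun y => score S.likelihood ζ i y) 2 (S.obsLaw ζ) := by
  simp_rw [score_likelihood hR hζ, obsLaw_eq]
  exact (memLp_colPairing_sub _ _ hR _).const_mul 2

/-- Each score carries a factor `2` and the second moment of the pairing a factor `1/2`. The sum
over columns is the trace. -/
theorem fim_apply (i j : Fin U × Fin 3) : S.fim ζ i j =
    2 * ((matPartialDeriv S.mean i ζ)ᴴ * S.noiseCov⁻¹ * matPartialDeriv S.mean j ζ).trace.re := by
  have h := integral_colPairing_sub_mul (S.meanCol ζ) S.covFactor hR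
    (fun t a => matPartialDeriv S.mean i ζ a t) fun t a => matPartialDeriv S.mean j ζ a t
  have h2 : ∀ x y : ℝ, 2 * x * (2 * y) = 4 * (x * y) := fun x y => by ring
  simp only [fim, fisherInformation, Matrix.of_apply]
  simp_rw [score_likelihood hR hζ, obsLaw_eq, h2]
  rw [integral_const_mul, h, colPairing_apply, noiseCov_eq, Matrix.trace, Complex.re_sum]
  rw [← mul_div_assoc, mul_comm (4 : ℝ), mul_div_assoc, mul_comm]
  congr 1
  · norm_num
  · refine Finset.sum_congr rfl fun t _ => ?_
    rw [Matrix.mul_assoc]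
    rfl

theorem peb_isLeast (hu : IsUnit (S.fim ζ).det) :
    S.peb ζ ^ 2 = (S.fim ζ)⁻¹.trace ∧
      IsLeast {e : ℝ | ∃ est, IsLocallyUnbiased S.obsLaw ζ est ∧ e = rmse S.obsLaw ζ est}
        (S.peb ζ) := by
  have hprob : IsProbabilityMeasure (S.obsLaw ζ) := by
    rw [obsLaw_eq]
    exact isProbabilityMeasure_gaussianColumns _ _ hR
  have h := cramerRao_isLeast S.obsLaw ζ (fun i y => score S.likelihood ζ i y) ?_
    (memLp_score hR hζ) ?_ (S.fim ζ) (fun i j => rfl) ?_ hu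
  -- Because `Real.sqrt` sends negative numbers to `0`, the identity for the square of the bound
  -- encodes that the trace is nonnegative.
  · exact ⟨Real.sq_sqrt h.1, h.2⟩
  · intro i
    simp_rw [score_likelihood hR hζ]
    exact Continuous.measurable (by fun_prop)
  · intro i
    simp_rw [score_likelihood hR hζ, obsLaw_eq]
    rw [integral_const_mul, integral_colPairing_sub _ _ hR, mul_zero]
  · intro f hf j
    simp_rw [score_likelihood hR hζ, obsLaw_eq]
    have hM := S.hasDerivAt_meanCol hζ j
    have hf' : MemLp f 2 (gaussianColumns (S.meanCol (Function.update ζ j (ζ j)))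
        (S.covFactor * S.covFactorᴴ)) := by
      rwa [Function.update_eq_self, ← obsLaw_eq]
    have h := hasDerivAt_integral_gaussianColumns S.covFactor hR hM hf'
    rwa [Function.update_eq_self] at h

end DMASystem

end

/-! ### The main theorem -/

theorem mainTheorem2 {NRF NE U T : ℕ} (S : DMASystem NRF NE U T)
    (hlam : 0 < S.lam) (hsigma : 0 < S.sigma) (hR : IsUnit S.noiseCov.det)
    {Ω : Type*} [MeasurableSpace Ω] (μ : Measure Ω) [IsProbabilityMeasure μ]
    (N : Ω → Matrix (Fin NRF × Fin NE) (Fin T) ℂ)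
    (hindep : iIndepFun (fun (t : Fin T) (ω : Ω) (a : Fin NRF × Fin NE) => N ω a t) μ)
    (hN : ∀ t : Fin T, HasLaw (fun (ω : Ω) (a : Fin NRF × Fin NE) => N ω a t)
      (complexGaussian 0 (((S.sigma : ℂ) ^ 2) • 1)) μ) :
    -- the received signal is complex Gaussian, with a covariance that is free of the positions
    (∀ z : Fin U × Fin 3 → ℝ,
      HasLaw (fun (ω : Ω) (t : Fin T) (a : Fin NRF) => S.received z (N ω) a t) (S.obsLaw z) μ ∧
      S.obsLaw z = (volume : Measure (Fin T → Fin NRF → ℂ)).withDensity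
        (fun y => ENNReal.ofReal (S.likelihood z y)) ∧
      (∀ a t, MemLp (fun ω => S.received z (N ω) a t) 2 μ) ∧
      (∀ a t, ∫ ω, S.received z (N ω) a t ∂μ = S.mean z a t) ∧
      (∀ a a' t t', ∫ ω, (S.received z (N ω) a t - S.mean z a t) *
          star (S.received z (N ω) a' t' - S.mean z a' t') ∂μ
        = if t = t' then S.noiseCov a a' else 0)) ∧
    ∀ ζ : Fin U × Fin 3 → ℝ, S.OffMicrostripLines ζ →
      -- the derivatives and expectations below exist
      (∀ u a, DifferentiableAt ℝ (fun z => S.h z u () a) ζ) ∧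
      (∀ y, DifferentiableAt ℝ (fun z => Real.log (S.likelihood z y)) ζ) ∧
      (∀ i j, Integrable
        (fun y => score S.likelihood ζ i y * score S.likelihood ζ j y) (S.obsLaw ζ)) ∧
      -- only the mean contributes to the Fisher information
      (∀ i j, S.fim ζ i j =
        2 * ((matPartialDeriv S.mean i ζ)ᴴ * S.noiseCov⁻¹ * matPartialDeriv S.mean j ζ).trace.re) ∧
      (∀ i, matPartialDeriv S.mean i ζ =
        S.Wᴴ * S.Pᴴ * ∑ u, matPartialDeriv (fun z => (S.h z u)ᴴ) i ζ * S.s u) ∧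
      -- the diagonal elements, as `T × T` matrices and as Fisher informations
      (∀ i, 2 • ((matPartialDeriv S.mean i ζ)ᴴ * S.noiseCov⁻¹ *
            matPartialDeriv S.mean i ζ).map Complex.re =
        2 • ∑ u, ((S.s u)ᴴ * matPartialDeriv (fun z => S.h z u) i ζ * S.P * S.F * S.Pᴴ *
            matPartialDeriv (fun z => (S.h z u)ᴴ) i ζ * S.s u).map Complex.re) ∧
      (∀ i, S.fim ζ i i =
        2 * ∑ u, ((S.s u)ᴴ * matPartialDeriv (fun z => S.h z u) i ζ * S.P * S.F * S.Pᴴ *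
            matPartialDeriv (fun z => (S.h z u)ᴴ) i ζ * S.s u).trace.re) ∧
      -- the position error bound is the smallest error of a locally unbiased estimator
      (IsUnit (S.fim ζ).det →
        S.peb ζ ^ 2 = (S.fim ζ)⁻¹.trace ∧
        IsLeast {e : ℝ | ∃ est, IsLocallyUnbiased S.obsLaw ζ est ∧ e = rmse S.obsLaw ζ est}
          (S.peb ζ)) := by
  rw [DMASystem.noiseCov_eq] at hR
  refine ⟨fun z => ⟨DMASystem.hasLaw_received hsigma hR hindep hN z, ?_,
    DMASystem.memLp_received hsigma hR hindep hN z,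
    DMASystem.integral_received hsigma hR hindep hN z,
    DMASystem.integral_received_mul_star hsigma hR hindep hN z⟩, fun ζ hζ =>
    ⟨S.differentiableAt_h hζ, DMASystem.differentiableAt_log_likelihood hR hζ,
      fun i j => integrable_fun_mul_of_memLp (DMASystem.memLp_score hR hζ i)
        (DMASystem.memLp_score hR hζ j),
      DMASystem.fim_apply hR hζ, S.matPartialDeriv_mean hζ, fun i => ?_, fun i => ?_,
      DMASystem.peb_isLeast hR hζ⟩⟩
  · simp_rw [DMASystem.likelihood_eq, DMASystem.obsLaw_eq]
    exact gaussianColumns_eq_withDensity (S.meanCol z) S.covFactor hR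
  · rw [S.matPartialDeriv_mean_quadratic hζ,
      S.sum_eq_single_user ζ i (fun A => A.map Complex.re) (by ext; simp)]
  · rw [DMASystem.fim_apply hR hζ, S.matPartialDeriv_mean_quadratic hζ,
      S.sum_eq_single_user ζ i (fun A => A.trace.re) (by simp)]
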